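/- A tensor-triangulated category is a triangulated category with a closed symmetric monoidal structure $(\otimes,\mathbb 1,[-,-])$ whose tensor product is exact in each variable, compatibly with suspension. An object $t$ of a triangulated category is compact if $\mathrm{Hom}(t,-)$ preserves coproducts; an object $x$ of a tensor-triangulated category is rigid if the natural map $[x,\mathbb 1]\otimes y\to[x,y]$ is an isomorphism for all $y$. The category is rigidly-compactly generated if it has all small coproducts, there is a set $\mathcal G$ of compact objects such that $\mathrm{Hom}(g,t)=0$ for all $g\in\mathcal G$ implies $t=0$, and the compact objects are exactly the rigid objects. **Theorem (Grothendieck–Neeman duality).** Let $\mathcal C$ and $\mathcal D$ be rigidly-compactly generated tensor-triangulated categories and let $f^*:\mathcal D\to\mathcal C$ be an exact strong symmetric monoidal functor that preserves coproducts. Then $f^*$ has a right adjoint $f_*$, which has a right adjoint $f^{(1)}$, and the canonical map $\pi: x\otimes f_*(y)\to f_*(f^*(x)\otimes y)$, adjoint to $f^*(x\otimes f_*y)\cong f^*x\otimes f^*f_*y\to f^*x\otimes y$, is an isomorphism, natural in $x\in\mathcal D$ and $y\in\mathcal C$. Put $\omega=f^{(1)}(\mathbb 1)$. The following conditions are equivalent: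 (a) $f^*$ has a left adjoint $f_{(1)}$; (b) $f^*$ preserves products; (c) $f^{(1)}$ has a right adjoint $f_{(-1)}$; (d) $f^{(1)}$ preserves coproducts; (e) $f_*$ preserves compact objects; (f) there is a natural isomorphism $\omega\otimes f^*(-)\cong f^{(1)}(-)$. If these hold, the adjoints $f_{(1)}\dashv f^*\dashv f_*\dashv f^{(1)}\dashv f_{(-1)}$ satisfy the following relations, given by canonical isomorphisms that are natural in all variables: 1. $\omega\otimes f^*(-)\cong f^{(1)}(-)$ (Grothendieck duality); 2. $f_{(-1)}\cong f_*[\omega,-]$; 3. $f^{(1)}(x)\otimes f^*(y)\cong f^{(1)}(x\otimes y)$; 4. $[x,f_{(-1)}y]\cong f_*[f^{(1)}x,y]$; 5. $[x,f_{(-1)}y]\cong f_{(-1)}[f^*x,y]$; 6. $f^*(-)\cong[\omega,f^{(1)}(-)]$; 7. $f_*(\omega\otimes-)\cong f_{(1)}(-)$ (ur-Wirthmüller isomorphism); 8. $x\otimes f_{(1)}(y)\cong f_{(1)}(f^*(x)\otimes y)$ (left projection formula); 9. $f^*[x,y]\cong[f^*x,f^*y]$; 10. $[f_{(1)}x,y]\cong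 f_*[x,f^*y]$; 11. $f_{(1)}(f^*x\otimes y)\cong f_*(f^{(1)}x\otimes y)$; 12. $[f^*x,f^*y]\cong[f^{(1)}x,f^{(1)}y]$; 13. $f_*[x,f^*y]\cong f_{(-1)}[x,f^{(1)}y]$; 14. $f^*\cong[\omega,\omega\otimes f^*(-)]$; 15. $\mathbb 1\cong[\omega,\omega]$. Here the canonical isomorphisms are the following. (3) is adjoint to $f_*(f^{(1)}x\otimes f^*y)\cong f_*f^{(1)}x\otimes y\to x\otimes y$, the inverse of $\pi$ (up to symmetry) followed by the counit of $f_*\dashv f^{(1)}$, and (1) is (3) at $x=\mathbb 1$. (7) is the composite $f_*(\omega\otimes x)\cong f_*(x\otimes\omega)\to f_*(f^*f_{(1)}x\otimes\omega)\cong f_{(1)}x\otimes f_*\omega\to f_{(1)}x$ of the unit of $f_{(1)}\dashv f^*$, $\pi^{-1}$, and the counit $f_*f^{(1)}\mathbb 1\to\mathbb 1$. (8) corresponds to $\pi$ under (7), and (11) is composed from (7) and (1). (2), (4), (5), (6) are obtained by passing to right adjoints in (1), in (3) with the first variable fixed, in (3) with the second variable fixed, and in (7), respectively; (9) and (10), and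 likewise (12) and (13), are obtained by passing to right adjoints in (8), respectively (11), with the variable in $\mathcal D$, respectively in $\mathcal C$, fixed. (14) is composed from (6) and (1), and (15) is (6) at $\mathbb 1$. -/

import Mathlib

open CategoryTheory Limits MonoidalCategory Opposite

universe v u u₁ u₂

noncomputable section

namespace GNDuality

section Categories

variable (C : Type u) [Category.{v} C]

variable {C} in
/-- The associator `(X ⊗ Y) ⊗ Z ⟶ X ⊗ (Y ⊗ Z)`, as a natural transformation in `Y`. -/
def middleAssociator [MonoidalCategory C] (X Z : C) :
    tensorLeft X ⋙ tensorRight Z ⟶ tensorRight Z ⋙ tensorLeft X where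
  app Y := (α_ X Y Z).hom

/-- A tensor-triangulated category: a triangulated category with a closed symmetric monoidal
structure, such that the tensor product is additive and exact in both variables, and such that the
suspension isomorphisms `X⟦m⟧ ⊗ Y ≅ (X ⊗ Y)⟦m⟧` and `X ⊗ Y⟦n⟧ ≅ (X ⊗ Y)⟦n⟧` (natural in both
variables, commuting with each other up to the sign `(-1) ^ (m * n)`: this is the instance argument
`CommShift₂Int`) are compatible with the unitors, the associator and the symmetry. -/
class TensorTriangulated [HasZeroObject C] [Preadditive C] [HasShift C ℤ]
    [∀ n : ℤ, (shiftFunctor C n).Additive] [Pretriangulated C] [IsTriangulated C]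
    [MonoidalCategory C] [SymmetricCategory C] [MonoidalClosed C] [MonoidalPreadditive C]
    [(curriedTensor C).CommShift₂Int] : Prop where
  tensorLeft_isTriangulated (X : C) : (tensorLeft X).IsTriangulated
  tensorRight_isTriangulated (X : C) : (tensorRight X).IsTriangulated
  leftUnitor_commShift : NatTrans.CommShift (leftUnitorNatIso C).hom ℤ
  rightUnitor_commShift : NatTrans.CommShift (rightUnitorNatIso C).hom ℤ
  braiding_commShift (X : C) :
    NatTrans.CommShift (BraidedCategory.tensorLeftIsoTensorRight X).hom ℤ
  associator_commShift₁ (Y Z : C) : NatTrans.CommShift (tensorRightTensor Y Z).hom ℤ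
  associator_commShift₂ (X Z : C) : NatTrans.CommShift (middleAssociator X Z) ℤ
  associator_commShift₃ (X Y : C) : NatTrans.CommShift (tensorLeftTensor X Y).hom ℤ

variable {C}

/-- The functor `F` preserves arbitrary (small) coproducts. -/
def PreservesCoproducts {E : Type u₁} [Category.{v} E] {E' : Type u₂} [Category.{v} E']
    (F : E ⥤ E') : Prop :=
  ∀ J : Type v, PreservesColimitsOfShape (Discrete J) F

/-- The functor `F` preserves arbitrary (small) products. -/
def PreservesProducts {E : Type u₁} [Category.{v} E] {E' : Type u₂} [Category.{v} E']
    (F : E ⥤ E') : Prop :=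
  ∀ J : Type v, PreservesLimitsOfShape (Discrete J) F

/-- `t` is compact: `Hom(t, -) : C ⥤ Ab` preserves arbitrary coproducts. -/
def IsCompactObj [Preadditive C] (t : C) : Prop :=
  ∀ J : Type v, PreservesColimitsOfShape (Discrete J) (preadditiveCoyoneda.obj (op t))

variable (C) in
/-- `C` has arbitrary coproducts and there is a set of compact objects `G` such that
`Hom(G, t) = 0` implies `t = 0`. -/
def IsCompactlyGenerated [Preadditive C] : Prop :=
  HasCoproducts.{v} C ∧ ∃ (ι : Type v) (G : ι → C), (∀ i, IsCompactObj (G i)) ∧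
    ∀ t : C, (∀ (i : ι) (φ : G i ⟶ t), φ = 0) → IsZero t

section

variable [MonoidalCategory C] [MonoidalClosed C]

/-- The natural map `[x, 𝟙] ⊗ y ⟶ [x, y]`. -/
def rigidMap (x y : C) : (ihom x).obj (𝟙_ C) ⊗ y ⟶ (ihom x).obj y :=
  MonoidalClosed.curry
    ((α_ x ((ihom x).obj (𝟙_ C)) y).inv ≫ (ihom.ev x).app (𝟙_ C) ▷ y ≫ (λ_ y).hom)

/-- `x` is rigid (strongly dualizable). -/
def IsRigidObj (x : C) : Prop := ∀ y : C, IsIso (rigidMap x y)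

variable (C) in
/-- Compactly generated, with compact objects and rigid objects coinciding. -/
def IsRigidlyCompactlyGenerated [Preadditive C] : Prop :=
  IsCompactlyGenerated C ∧ ∀ x : C, IsCompactObj x ↔ IsRigidObj x

/-- The adjunction `- ⊗ x ⊣ [x, -]` in a closed symmetric monoidal category. -/
def tensorRightAdj [SymmetricCategory C] (x : C) : tensorRight x ⊣ ihom x :=
  (ihom.adjunction x).ofNatIsoLeft (BraidedCategory.tensorLeftIsoTensorRight x)

end

end Categories

/-! Throughout, `F` is `f^*`, `G` is `f_*`, `H` is `f^{(1)}`, `L` is `f_{(1)}`, `K` is `f_{(-1)}`,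
so that `L ⊣ F ⊣ G ⊣ H ⊣ K`. -/

section Functors

variable {C : Type u₁} [Category.{v} C] [MonoidalCategory C] [SymmetricCategory C]
  [MonoidalClosed C]
  {D : Type u₂} [Category.{v} D] [MonoidalCategory D] [SymmetricCategory D] [MonoidalClosed D]
  {F : D ⥤ C} {G : C ⥤ D} {H : D ⥤ C} {L K : C ⥤ D}

/-- The projection map `x ⊗ f_* y ⟶ f_* (f^* x ⊗ y)`, adjoint to
`f^* (x ⊗ f_* y) ≅ f^* x ⊗ f^* f_* y ⟶ f^* x ⊗ y`. -/
def projMap [F.Braided] (adj₁ : F ⊣ G) (x : D) (y : C) :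
    x ⊗ G.obj y ⟶ G.obj (F.obj x ⊗ y) :=
  adj₁.homEquiv _ _ (Functor.OplaxMonoidal.δ F x (G.obj y) ≫ F.obj x ◁ adj₁.counit.app y)

variable (F G) in
/-- The type of isomorphisms `x ⊗ f_* y ≅ f_* (f^* x ⊗ y)` natural in `x : D` and `y : C`. -/
abbrev ProjIso : Type _ :=
  curriedTensor D ⋙ (Functor.whiskeringLeft C D D).obj G ≅
    F ⋙ curriedTensor C ⋙ (Functor.whiskeringRight C C D).obj G

variable (H) in
/-- The relative dualizing object `ω = f^{(1)}(𝟙)`. -/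
abbrev dualizingObj : C := H.obj (𝟙_ D)

/-- The comparison map `f^{(1)} x ⊗ f^* y ⟶ f^{(1)} (x ⊗ y)`, adjoint to
`f_* (f^{(1)} x ⊗ f^* y) ≅ f_* f^{(1)} x ⊗ y ⟶ x ⊗ y`
(projection formula followed by the counit). -/
def genGrothMap (π : ProjIso F G) (adj₂ : G ⊣ H) (x y : D) :
    H.obj x ⊗ F.obj y ⟶ H.obj (x ⊗ y) :=
  adj₂.homEquiv _ _
    (G.map (β_ (H.obj x) (F.obj y)).hom ≫ (π.inv.app y).app (H.obj x) ≫
      (β_ y (G.obj (H.obj x))).hom ≫ adj₂.counit.app x ▷ y)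

/-- The case `x = 𝟙` of the previous map, `ω ⊗ f^* y ⟶ f^{(1)} (𝟙 ⊗ y) ≅ f^{(1)} y`. -/
def grothMap (π : ProjIso F G) (adj₂ : G ⊣ H) (y : D) :
    dualizingObj H ⊗ F.obj y ⟶ H.obj y :=
  genGrothMap π adj₂ (𝟙_ D) y ≫ H.map (λ_ y).hom

/-- The ur-Wirthmüller map: the composite
`f_* (ω ⊗ x) ≅ f_* (x ⊗ ω) ⟶ f_* (f^* f_{(1)} x ⊗ ω) ≅ f_{(1)} x ⊗ f_* f^{(1)} 𝟙 ⟶ f_{(1)} x`. -/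
def urWirthMap (π : ProjIso F G) (adj₀ : L ⊣ F) (adj₂ : G ⊣ H) (x : C) :
    G.obj (dualizingObj H ⊗ x) ⟶ L.obj x :=
  G.map (β_ (dualizingObj H) x).hom ≫ G.map (adj₀.unit.app x ▷ dualizingObj H) ≫
    (π.inv.app (L.obj x)).app (dualizingObj H) ≫
    L.obj x ◁ adj₂.counit.app (𝟙_ D) ≫ (ρ_ (L.obj x)).hom

/-- The permutation `f^* x ⊗ (ω ⊗ y) ≅ ω ⊗ (f^* x ⊗ y)`. -/
def swapIso (a b c : C) : a ⊗ (b ⊗ c) ≅ b ⊗ (a ⊗ c) :=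
  (α_ a b c).symm ≪≫ whiskerRightIso (β_ a b) c ≪≫ α_ b a c

open Functor MonoidalClosed in
/-- The canonical natural isomorphisms relating `f_{(1)} ⊣ f^* ⊣ f_* ⊣ f^{(1)} ⊣ f_{(-1)}`.
Each isomorphism is natural in all its variables, and a second field says which one it is: an
explicit map, a composite of previous ones, or the conjugate of a previous one, obtained by passing
to right adjoints (`conjugateEquiv`), for two-variable formulas with one variable fixed. -/
structure DualityIsos [F.Braided] (π : ProjIso F G) (adj₀ : L ⊣ F) (adj₁ : F ⊣ G) (adj₂ : G ⊣ H)
    (adj₃ : H ⊣ K) where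
  /-- Grothendieck duality `ω ⊗ f^* ≅ f^{(1)}`. -/
  groth : F ⋙ tensorLeft (dualizingObj H) ≅ H
  groth_hom (y : D) : groth.hom.app y = grothMap π adj₂ y
  /-- `f_{(-1)} ≅ f_* [ω, -]`. -/
  coGroth : K ≅ ihom (dualizingObj H) ⋙ G
  coGroth_hom : coGroth.hom =
    conjugateEquiv adj₃ (adj₁.comp (ihom.adjunction (dualizingObj H))) groth.hom
  /-- `f^{(1)} x ⊗ f^* y ≅ f^{(1)} (x ⊗ y)`. -/
  genGroth : H ⋙ curriedTensor C ⋙ (whiskeringLeft D C C).obj F ≅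
    curriedTensor D ⋙ (whiskeringRight D D C).obj H
  genGroth_hom (x y : D) : (genGroth.hom.app x).app y = genGrothMap π adj₂ x y
  /-- `[x, f_{(-1)} y] ≅ f_* [f^{(1)} x, y]`. -/
  genCoGroth : internalHom ⋙ (whiskeringLeft C D D).obj K ≅
    H.op ⋙ internalHom ⋙ (whiskeringRight C C D).obj G
  genCoGroth_hom (x : D) : genCoGroth.hom.app (op x) =
    conjugateEquiv ((ihom.adjunction x).comp adj₃)
      (adj₁.comp (ihom.adjunction (H.obj x))) (genGroth.hom.app x)
  /-- `[x, f_{(-1)} y] ≅ f_{(-1)} [f^* x, y]`. -/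
  pseudoInthom : internalHom ⋙ (whiskeringLeft C D D).obj K ≅
    F.op ⋙ internalHom ⋙ (whiskeringRight C C D).obj K
  pseudoInthom_hom (x : D) : pseudoInthom.hom.app (op x) =
    conjugateEquiv ((tensorRightAdj x).comp adj₃)
      (adj₃.comp (tensorRightAdj (F.obj x))) (genGroth.hom.flipApp x)
  /-- The ur-Wirthmüller isomorphism `f_* (ω ⊗ -) ≅ f_{(1)}`. -/
  urWirth : tensorLeft (dualizingObj H) ⋙ G ≅ L
  urWirth_hom (x : C) : urWirth.hom.app x = urWirthMap π adj₀ adj₂ x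
  /-- `f^* ≅ [ω, f^{(1)} -]`. -/
  coWirth : F ≅ H ⋙ ihom (dualizingObj H)
  coWirth_hom : coWirth.hom =
    conjugateEquiv adj₀ ((ihom.adjunction (dualizingObj H)).comp adj₂) urWirth.hom
  /-- The left projection formula `x ⊗ f_{(1)} y ≅ f_{(1)} (f^* x ⊗ y)`. -/
  leftProj : curriedTensor D ⋙ (whiskeringLeft C D D).obj L ≅
    F ⋙ curriedTensor C ⋙ (whiskeringRight C C D).obj L
  leftProj_hom (x : D) (y : C) : x ◁ urWirth.hom.app y ≫ (leftProj.hom.app x).app y =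
    (π.hom.app x).app (dualizingObj H ⊗ y) ≫
      G.map (swapIso (F.obj x) (dualizingObj H) y).hom ≫ urWirth.hom.app (F.obj x ⊗ y)
  /-- `f^* [x, y] ≅ [f^* x, f^* y]`. -/
  closed : internalHom ⋙ (whiskeringRight D D C).obj F ≅
    F.op ⋙ internalHom ⋙ (whiskeringLeft D C C).obj F
  closed_hom (x : D) : closed.hom.app (op x) =
    conjugateEquiv (adj₀.comp (ihom.adjunction x))
      ((ihom.adjunction (F.obj x)).comp adj₀) (leftProj.inv.app x)
  /-- `[f_{(1)} x, y] ≅ f_* [x, f^* y]`. -/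
  coLeftProj : L.op ⋙ internalHom ≅
    internalHom ⋙ (whiskeringLeft D C C).obj F ⋙ (whiskeringRight D C D).obj G
  coLeftProj_hom (x : C) : coLeftProj.hom.app (op x) =
    conjugateEquiv (tensorRightAdj (L.obj x))
      ((adj₁.comp (tensorRightAdj x)).comp adj₀) (leftProj.inv.flipApp x)
  /-- `f_{(1)} (f^* x ⊗ y) ≅ f_* (f^{(1)} x ⊗ y)`. -/
  mixed : F ⋙ curriedTensor C ⋙ (whiskeringRight C C D).obj L ≅
    H ⋙ curriedTensor C ⋙ (whiskeringRight C C D).obj G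
  mixed_hom (x : D) (y : C) : (mixed.hom.app x).app y =
    urWirth.inv.app (F.obj x ⊗ y) ≫ G.map (α_ (dualizingObj H) (F.obj x) y).inv ≫
      G.map (groth.hom.app x ▷ y)
  /-- `[f^* x, f^* y] ≅ [f^{(1)} x, f^{(1)} y]`. -/
  mixedHom : F.op ⋙ internalHom ⋙ (whiskeringLeft D C C).obj F ≅
    H.op ⋙ internalHom ⋙ (whiskeringLeft D C C).obj H
  mixedHom_hom (x : D) : mixedHom.hom.app (op x) =
    conjugateEquiv ((ihom.adjunction (F.obj x)).comp adj₀)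
      ((ihom.adjunction (H.obj x)).comp adj₂) (mixed.inv.app x)
  /-- `f_* [x, f^* y] ≅ f_{(-1)} [x, f^{(1)} y]`. -/
  mixedPush : internalHom ⋙ (whiskeringLeft D C C).obj F ⋙ (whiskeringRight D C D).obj G ≅
    internalHom ⋙ (whiskeringLeft D C C).obj H ⋙ (whiskeringRight D C D).obj K
  mixedPush_hom (x : C) : mixedPush.hom.app (op x) =
    conjugateEquiv ((adj₁.comp (tensorRightAdj x)).comp adj₀)
      ((adj₃.comp (tensorRightAdj x)).comp adj₂) (mixed.inv.flipApp x)
  /-- `f^* ≅ [ω, ω ⊗ f^* -]`. -/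
  coWirthGroth : F ≅ F ⋙ tensorLeft (dualizingObj H) ⋙ ihom (dualizingObj H)
  coWirthGroth_hom (y : D) : coWirthGroth.hom.app y =
    coWirth.hom.app y ≫ (ihom (dualizingObj H)).map (groth.inv.app y)
  /-- `𝟙 ≅ [ω, ω]`. -/
  unitIso : 𝟙_ C ≅ (ihom (dualizingObj H)).obj (dualizingObj H)
  unitIso_hom : unitIso.hom = Functor.LaxMonoidal.ε F ≫ coWirth.hom.app (𝟙_ D)

end Functors

end GNDuality

end

set_option linter.unusedSectionVars false

noncomputable section

namespace GNDuality

/-! ### Compact objects and finite sums of morphisms into coproducts. -/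

section Sums

/-! Two principles carry the theorem: what is generated by compact objects can be tested on them,
and compact objects, being rigid, have duals.

Brown representability (`IsBrownFunctor.exists_representing`) gives a right adjoint to every
coproduct-preserving triangulated functor out of a compactly generated category. This yields `f_*`.
Strong monoidal functors preserve dual pairs, so `f^*` preserves rigid objects, that is, compact
ones. Hence `f_*` preserves coproducts and `f^{(1)}` exists as well.

A transformation between coproduct-preserving triangulated functors is invertible as soon as it is
so on compact objects (`IsCompactlyGenerated.isIso_app`). Tensoring with a rigid object is adjoint
to tensoring with its dual, so on rigid objects the projection map and the Grothendieck map are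
invertible by a Yoneda argument (`isIso_homEquiv_of_adjunctions`). The projection formula then holds
everywhere, and Grothendieck duality holds everywhere exactly when `f^{(1)}` preserves coproducts,
which is also the condition that `f_*` preserves compact objects.

Two implications lie deeper. If `f^*` preserves products and `c` is compact, the projection formula
writes `- ⊗ f_* c` as a product-preserving functor. So `Hom(𝟙, - ⊗ f_* c)` is homological and
preserves products and coproducts. Such a functor is corepresented by a compact object `z`
(`exists_corepresenting`), and then `f_* c` is the dual of `z`, hence compact
(`isCompactObj_of_corepresents`).

Conversely, suppose that `f_*` preserves compact objects. For `c` compact with dual `c'`, the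
objects `f_* (ω ⊗ c)` and `f_* c'` are then dual to each other, which gives `Hom(c, f^* y) ≅ Hom(𝟙,
y ⊗ f_* c') ≅ Hom(f_* (ω ⊗ c), y)`. So `f^* ≅ [ω, f^{(1)} -]` (`isIso_coWirthNat`), and the right
side has the left adjoint `f_* (ω ⊗ -)`. The ur-Wirthmüller map is the conjugate of this
isomorphism; the remaining relations are composites and conjugates of those already obtained. -/

lemma exists_sum_add_sum {J B : Type*} [AddCommGroup B] {A : J → Type*} [∀ j, AddCommGroup (A j)]
    (f : ∀ j, A j →+ B) (s t : Finset J) (g h : ∀ j, A j) :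
    ∃ (r : Finset J) (k : ∀ j, A j),
      ∑ j ∈ s, f j (g j) + ∑ j ∈ t, f j (h j) = ∑ j ∈ r, f j (k j) := by
  classical
  refine ⟨s ∪ t, fun j ↦ (if j ∈ s then g j else 0) + (if j ∈ t then h j else 0), ?_⟩
  simp only [map_add, Finset.sum_add_distrib]
  congr 1
  · rw [← Finset.sum_subset (Finset.subset_union_left (s₁ := s) (s₂ := t))]
    · exact Finset.sum_congr rfl fun j hj ↦ by simp [hj]
    · intro j _ hj; simp [hj]
  · rw [← Finset.sum_subset (Finset.subset_union_right (s₁ := s) (s₂ := t))]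
    · exact Finset.sum_congr rfl fun j hj ↦ by simp [hj]
    · intro j _ hj; simp [hj]

variable {T : Type u} [Category.{v} T]

/-- Every element of `M (∐ X)` is a finite sum of elements coming from the `M (X j)`. -/
def IsSumGenerated (M : T ⥤ AddCommGrpCat.{v}) : Prop :=
  ∀ (J : Type v) (X : J → T) [HasCoproduct X] (m : M.obj (∐ X)),
    ∃ (s : Finset J) (g : ∀ j, M.obj (X j)), m = ∑ j ∈ s, M.map (Sigma.ι X j) (g j)

/-- The quotient by the subgroup generated by the images of the `M (X j)` receives the zero map from
every summand, so the quotient map vanishes by the universal property. -/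
lemma isSumGenerated_of_preservesCoproducts (M : T ⥤ AddCommGrpCat.{v})
    (hM : PreservesCoproducts M) : IsSumGenerated M := by
  classical
  intro J X _ m
  let K : AddSubgroup (M.obj (∐ X)) :=
    AddSubgroup.closure {x | ∃ (j : J) (y : M.obj (X j)), x = M.map (Sigma.ι X j) y}
  have hK : K = ⊤ := by
    let q : M.obj (∐ X) ⟶ AddCommGrpCat.of (M.obj (∐ X) ⧸ K) :=
      AddCommGrpCat.ofHom (QuotientAddGroup.mk' K)
    have := hM J
    have hq : q = 0 := by
      refine (isColimitOfPreserves M (coproductIsCoproduct X)).hom_ext fun ⟨j⟩ ↦ ?_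
      ext y
      exact (QuotientAddGroup.eq_zero_iff _).2 (AddSubgroup.subset_closure ⟨j, y, rfl⟩)
    refine (AddSubgroup.eq_top_iff' _).2 fun x ↦ (QuotientAddGroup.eq_zero_iff x).1 ?_
    exact congr($hq x)
  have hm : m ∈ K := by simp [hK]
  induction hm using AddSubgroup.closure_induction with
  | mem x hx =>
    obtain ⟨j, y, rfl⟩ := hx
    exact ⟨{j}, fun k ↦ if h : k = j then h ▸ y else 0, by simp⟩
  | zero => exact ⟨∅, fun _ ↦ 0, by simp⟩
  | add x y _ _ hx hy =>
    obtain ⟨s, g, rfl⟩ := hx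
    obtain ⟨t, h, rfl⟩ := hy
    exact exists_sum_add_sum (fun j ↦ (M.map (Sigma.ι X j)).hom) s t g h
  | neg x _ hx =>
    obtain ⟨s, g, rfl⟩ := hx
    exact ⟨s, fun j ↦ - g j, by simp⟩

variable [Preadditive T]

lemma map_sigmaπ_map_sigmaι (M : T ⥤ AddCommGrpCat.{v}) [M.PreservesZeroMorphisms]
    {J : Type v} [DecidableEq J] (X : J → T) [HasCoproduct X] (s : Finset J)
    (g : ∀ j, M.obj (X j)) (j : J)
    (hj : j ∈ s) :
    M.map (Sigma.π X j) (∑ k ∈ s, M.map (Sigma.ι X k) (g k)) = g j := by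
  rw [map_sum, Finset.sum_eq_single j]
  · rw [← ConcreteCategory.comp_apply, ← M.map_comp, Sigma.ι_π_eq_id]
    simp
  · intro k _ hk
    rw [← ConcreteCategory.comp_apply, ← M.map_comp, Sigma.ι_π_of_ne _ hk]
    simp
  · exact fun h ↦ (h hj).elim

/-- Zero morphisms provide projections from a coproduct to its summands. These separate the terms of
a finite sum, so the comparison map is injective; finite-sum generation is its surjectivity. -/
lemma preservesCoproducts_of_isSumGenerated [HasCoproducts.{v} T] (M : T ⥤ AddCommGrpCat.{v})
    [M.PreservesZeroMorphisms] (hM : IsSumGenerated M) : PreservesCoproducts M := by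
  classical
  intro J
  have (X : J → T) : PreservesColimit (Discrete.functor X) M := by
    have : IsIso (sigmaComparison M X) := by
      rw [ConcreteCategory.isIso_iff_bijective]
      have key (k : J) (x) : sigmaComparison M X (Sigma.ι (fun j ↦ M.obj (X j)) k x) =
          M.map (Sigma.ι X k) x := by
        rw [← ConcreteCategory.comp_apply, ι_comp_sigmaComparison]
      constructor
      · rw [injective_iff_map_eq_zero]
        intro x hx
        -- For the identity functor, the earlier lemma describes the elements of a coproduct of
        -- abelian groups.
        obtain ⟨s, g, rfl⟩ := isSumGenerated_of_preservesCoproducts (𝟭 AddCommGrpCat.{v})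
          (fun _ ↦ inferInstance) J (fun j ↦ M.obj (X j)) x
        refine Finset.sum_eq_zero fun j hj ↦ ?_
        have h := map_sigmaπ_map_sigmaι M X s g j hj
        rw [map_sum] at hx
        simp only [Functor.id_map, key] at hx
        rw [hx, map_zero] at h
        simp [← h]
      · intro y
        obtain ⟨s, g, rfl⟩ := hM J X y
        exact ⟨∑ j ∈ s, Sigma.ι (fun j ↦ M.obj (X j)) j (g j), by simp [map_sum, key]⟩
    exact PreservesCoproduct.of_iso_comparison M X
  exact preservesColimitsOfShape_of_discrete M

/-- Every morphism from a compact object to a coproduct is a finite sum of morphisms to the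
summands. -/
lemma IsCompactObj.exists_eq_sum {t : T} (ht : IsCompactObj t) {J : Type v} (X : J → T)
    [HasCoproduct X] (f : t ⟶ ∐ X) :
    ∃ (s : Finset J) (g : ∀ j, t ⟶ X j), f = ∑ j ∈ s, g j ≫ Sigma.ι X j :=
  isSumGenerated_of_preservesCoproducts _ ht J X f

lemma isCompactObj_of_exists_eq_sum [HasCoproducts.{v} T] {t : T}
    (h : ∀ (J : Type v) (X : J → T) (f : t ⟶ ∐ X),
      ∃ (s : Finset J) (g : ∀ j, t ⟶ X j), f = ∑ j ∈ s, g j ≫ Sigma.ι X j) : IsCompactObj t :=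
  preservesCoproducts_of_isSumGenerated _ fun J X _ f ↦ h J X f

lemma sum_comp_sigmaι_π {t : T} {J : Type v} [DecidableEq J] (X : J → T) [HasCoproduct X] (s : Finset J)
    (g : ∀ j, t ⟶ X j) (j : J) (hj : j ∈ s) :
    (∑ k ∈ s, g k ≫ Sigma.ι X k) ≫ Sigma.π X j = g j :=
  map_sigmaπ_map_sigmaι (preadditiveCoyoneda.obj (op t)) X s g j hj

lemma IsCompactObj.of_retract [HasCoproducts.{v} T] {t t' : T} (ht : IsCompactObj t)
    (i : t' ⟶ t) (r : t ⟶ t') (h : i ≫ r = 𝟙 t') : IsCompactObj t' :=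
  isCompactObj_of_exists_eq_sum fun J X f ↦ by
    obtain ⟨s, g, hg⟩ := ht.exists_eq_sum X (r ≫ f)
    refine ⟨s, fun j ↦ i ≫ g j, ?_⟩
    rw [← Category.id_comp f, ← h, Category.assoc, hg, Preadditive.comp_sum]
    simp

lemma IsCompactObj.of_iso [HasCoproducts.{v} T] {t t' : T} (ht : IsCompactObj t) (e : t ≅ t') :
    IsCompactObj t' :=
  ht.of_retract e.inv e.hom (by simp)

variable {S : Type u₁} [Category.{v} S] [Preadditive S]

/-- A left adjoint of a coproduct-preserving functor preserves compact objects. -/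
lemma IsCompactObj.of_adjunction [HasCoproducts.{v} T] [HasCoproducts.{v} S] {A : S ⥤ T}
    {B : T ⥤ S} [A.Additive] (adj : A ⊣ B) (hB : PreservesCoproducts B) {t : S}
    (ht : IsCompactObj t) : IsCompactObj (A.obj t) :=
  isCompactObj_of_exists_eq_sum fun J X f ↦ by
    have := hB J
    obtain ⟨s, g, hg⟩ := ht.exists_eq_sum (fun j ↦ B.obj (X j))
      (adj.homEquiv _ _ f ≫ inv (sigmaComparison B X))
    refine ⟨s, fun j ↦ (adj.homEquiv _ _).symm (g j), ?_⟩
    apply (adj.homEquiv _ _).injective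
    rw [IsIso.comp_inv_eq, Preadditive.sum_comp] at hg
    rw [hg, ← Equiv.symm_apply_eq]
    simp [adj.homEquiv_counit, Functor.map_sum, Preadditive.sum_comp]

lemma IsCompactObj.shift [HasCoproducts.{v} T] [HasShift T ℤ]
    [∀ n : ℤ, (shiftFunctor T n).Additive] {t : T} (ht : IsCompactObj t) (n : ℤ) :
    IsCompactObj (t⟦n⟧) :=
  IsCompactObj.of_adjunction (A := shiftFunctor T n) (shiftEquiv T n).toAdjunction (fun _ ↦ inferInstance) ht

end Sums

/-! ### Compact objects in distinguished triangles. -/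

section Compact

variable {T : Type u} [Category.{v} T] [HasZeroObject T] [Preadditive T] [HasShift T ℤ]
  [∀ n : ℤ, (shiftFunctor T n).Additive] [Pretriangulated T]

open Pretriangulated

/-- The restriction of `f` to the second object is a finite sum whose terms extend separately to the
cone. What remains of `f` factors through the shift of the first object, which is compact. -/
lemma IsCompactObj.cone [HasCoproducts.{v} T] (S : Triangle T) (hS : S ∈ distTriang T)
    (h₁ : IsCompactObj S.obj₁) (h₂ : IsCompactObj S.obj₂) : IsCompactObj S.obj₃ :=
  isCompactObj_of_exists_eq_sum fun J X f ↦ by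
    classical
    obtain ⟨s, g, hg⟩ := h₂.exists_eq_sum X (S.mor₂ ≫ f)
    have hg₀ (j : J) (hj : j ∈ s) : S.mor₁ ≫ g j = 0 := by
      rw [← sum_comp_sigmaι_π X s (fun j ↦ S.mor₁ ≫ g j) j hj]
      have : ∑ k ∈ s, (S.mor₁ ≫ g k) ≫ Sigma.ι X k = 0 := by
        simp only [Category.assoc]
        rw [← Preadditive.comp_sum, ← hg, ← Category.assoc, comp_distTriang_mor_zero₁₂ _ hS,
          zero_comp]
      rw [this, zero_comp]
    have (j : J) : ∃ h : S.obj₃ ⟶ X j, j ∈ s → g j = S.mor₂ ≫ h := by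
      by_cases hj : j ∈ s
      · obtain ⟨h, hh⟩ := S.yoneda_exact₂ hS (g j) (hg₀ j hj)
        exact ⟨h, fun _ ↦ hh⟩
      · exact ⟨0, fun h ↦ (hj h).elim⟩
    choose h hh using this
    obtain ⟨k, hk⟩ := S.yoneda_exact₃ hS (f - ∑ j ∈ s, h j ≫ Sigma.ι X j) (by
      rw [Preadditive.comp_sub, hg, Preadditive.comp_sum, sub_eq_zero]
      exact Finset.sum_congr rfl fun j hj ↦ by rw [hh j hj, Category.assoc])
    obtain ⟨s', g', rfl⟩ := (h₁.shift 1).exists_eq_sum X k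
    obtain ⟨r, l, hl⟩ := exists_sum_add_sum (fun j ↦ Preadditive.rightComp S.obj₃ (Sigma.ι X j))
      s s' h (fun j ↦ S.mor₃ ≫ g' j)
    refine ⟨r, l, Eq.trans ?_ hl⟩
    rw [sub_eq_iff_eq_add] at hk
    rw [hk, add_comm]
    simp [Preadditive.comp_sum, Preadditive.rightComp]

lemma exists_map_eq_of_distTriang (M : T ⥤ AddCommGrpCat.{v}) [M.IsHomological] (S : Triangle T)
    (hS : S ∈ distTriang T) (x : M.obj S.obj₂) (hx : M.map S.mor₂ x = 0) :
    ∃ y : M.obj S.obj₁, M.map S.mor₁ y = x :=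
  (ShortComplex.ab_exact_iff _).1 (M.map_distinguished_exact S hS) x hx

end Compact

/-! ### Sequential homotopy colimits. -/

section Sequences

variable {T : Type u} [Category.{v} T] [Preadditive T] [HasCoproducts.{v} T]

/-- The coproduct of a sequence of objects. -/
abbrev seqCoproduct (X : ℕ → T) : T := ∐ fun n : ULift.{v} ℕ ↦ X n.down

/-- The inclusion of a term of a sequence into the coproduct. -/
abbrev seqι (X : ℕ → T) (n : ℕ) : X n ⟶ seqCoproduct X :=
  Sigma.ι (fun n : ULift.{v} ℕ ↦ X n.down) ⟨n⟩

/-- The projection of the coproduct of a sequence to one of its terms. -/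
abbrev seqπ (X : ℕ → T) (n : ℕ) : seqCoproduct X ⟶ X n :=
  Sigma.π (fun n : ULift.{v} ℕ ↦ X n.down) ⟨n⟩

/-- The map `1 - shift` whose cone is the homotopy colimit of a sequence. -/
def oneSubShift (X : ℕ → T) (φ : ∀ n, X n ⟶ X (n + 1)) : seqCoproduct X ⟶ seqCoproduct X :=
  Sigma.desc fun n ↦ seqι X n.down - φ n.down ≫ seqι X (n.down + 1)

variable (X : ℕ → T) (φ : ∀ n, X n ⟶ X (n + 1))

lemma seqι_oneSubShift (n : ℕ) :
    seqι X n ≫ oneSubShift X φ = seqι X n - φ n ≫ seqι X (n + 1) := by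
  simp [oneSubShift, seqι]

lemma seqι_π_self (n : ℕ) : seqι X n ≫ seqπ X n = 𝟙 _ := by
  classical exact Sigma.ι_π_eq_id _ _

lemma seqι_π_of_ne (n m : ℕ) (h : n ≠ m) : seqι X n ≫ seqπ X m = 0 := by
  classical exact Sigma.ι_π_of_ne _ (by simpa using h)

lemma oneSubShift_π_zero : oneSubShift X φ ≫ seqπ X 0 = seqπ X 0 := by
  refine Sigma.hom_ext _ _ fun ⟨n⟩ ↦ ?_
  change seqι X n ≫ _ = seqι X n ≫ _
  rw [reassoc_of% seqι_oneSubShift X φ n, Preadditive.sub_comp, Category.assoc,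
    seqι_π_of_ne X (n + 1) 0 (by simp), comp_zero, sub_zero]

lemma oneSubShift_π_succ (m : ℕ) :
    oneSubShift X φ ≫ seqπ X (m + 1) = seqπ X (m + 1) - seqπ X m ≫ φ m := by
  refine Sigma.hom_ext _ _ fun ⟨n⟩ ↦ ?_
  change seqι X n ≫ _ = seqι X n ≫ _
  rw [reassoc_of% seqι_oneSubShift X φ n, Preadditive.sub_comp, Category.assoc, Preadditive.comp_sub]
  congr 1
  by_cases h : n = m
  · subst h
    rw [seqι_π_self, ← Category.assoc, seqι_π_self, Category.id_comp, Category.comp_id]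
  · rw [seqι_π_of_ne X _ _ (by simpa using h), ← Category.assoc, seqι_π_of_ne X _ _ h, comp_zero,
      zero_comp]

/-- The projections of `f` vanish inductively: the zeroth is unchanged by `1 - shift`, and each
later one is determined by its predecessor. Compactness is what makes a morphism with zero
projections zero. -/
lemma eq_zero_of_comp_oneSubShift {t : T} (ht : IsCompactObj t) (f : t ⟶ seqCoproduct X)
    (hf : f ≫ oneSubShift X φ = 0) : f = 0 := by
  classical
  have h (n : ℕ) : f ≫ seqπ X n = 0 := by
    induction n with
    | zero => rw [← oneSubShift_π_zero X φ, reassoc_of% hf, zero_comp]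
    | succ n hn =>
      have := oneSubShift_π_succ X φ n
      rw [eq_sub_iff_add_eq] at this
      rw [← this, Preadditive.comp_add, reassoc_of% hf, reassoc_of% hn, zero_comp, zero_comp,
        add_zero]
  obtain ⟨s, g, rfl⟩ := ht.exists_eq_sum _ f
  refine Finset.sum_eq_zero fun j hj ↦ ?_
  have := h j.down
  rw [sum_comp_sigmaι_π _ s g j hj] at this
  rw [this, zero_comp]

end Sequences

section Hocolim

open Pretriangulated

variable {T : Type u} [Category.{v} T] [HasZeroObject T] [Preadditive T] [HasShift T ℤ]
  [∀ n : ℤ, (shiftFunctor T n).Additive] [Pretriangulated T] [HasCoproducts.{v} T]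

variable (X : ℕ → T) (φ : ∀ n, X n ⟶ X (n + 1)) {Z : T} {p : seqCoproduct X ⟶ Z}
  {d : Z ⟶ (seqCoproduct X)⟦(1 : ℤ)⟧}

lemma seqι_comp_eq (hZ : Triangle.mk (oneSubShift X φ) p d ∈ distTriang T) (n : ℕ) :
    seqι X n ≫ p = φ n ≫ seqι X (n + 1) ≫ p := by
  have h : oneSubShift X φ ≫ p = 0 := comp_distTriang_mor_zero₁₂ _ hZ
  have := reassoc_of% seqι_oneSubShift X φ n
  replace this := this p
  rwa [h, comp_zero, Preadditive.sub_comp, eq_comm, sub_eq_zero, Category.assoc] at this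

lemma exists_comp_seqι_of_le (hZ : Triangle.mk (oneSubShift X φ) p d ∈ distTriang T) {t : T}
    {n m : ℕ} (hnm : n ≤ m) (g : t ⟶ X n) :
    ∃ g' : t ⟶ X m, g ≫ seqι X n ≫ p = g' ≫ seqι X m ≫ p := by
  induction m, hnm using Nat.le_induction with
  | base => exact ⟨g, rfl⟩
  | succ m _ h =>
    obtain ⟨g', hg'⟩ := h
    exact ⟨g' ≫ φ m, by rw [hg', seqι_comp_eq X φ hZ m, Category.assoc]⟩

/-- A morphism from a compact object to a homotopy colimit factors through one of the terms. -/
lemma exists_factor_seqι (hZ : Triangle.mk (oneSubShift X φ) p d ∈ distTriang T) {t : T}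
    (ht : IsCompactObj t) (f : t ⟶ Z) : ∃ (n : ℕ) (g : t ⟶ X n), f = g ≫ seqι X n ≫ p := by
  -- Transposed to a morphism out of `t⟦-1⟧`, this composite is killed by `1 - shift`, which is
  -- injective on morphisms from compact objects.
  have hd : f ≫ d = 0 := by
    let adj : shiftFunctor T (-1 : ℤ) ⊣ shiftFunctor T (1 : ℤ) :=
      (shiftEquiv T (1 : ℤ)).symm.toAdjunction
    obtain ⟨v, hv⟩ := (adj.homEquiv _ _).surjective (f ≫ d)
    rw [← hv, eq_zero_of_comp_oneSubShift X φ (ht.shift (-1)) v, adj.homEquiv_unit,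
      Functor.map_zero, comp_zero]
    apply (adj.homEquiv _ _).injective
    have h31 : d ≫ (oneSubShift X φ)⟦(1 : ℤ)⟧' = 0 := comp_distTriang_mor_zero₃₁ _ hZ
    rw [adj.homEquiv_naturality_right, hv, Category.assoc, h31, comp_zero, adj.homEquiv_unit,
      Functor.map_zero, comp_zero]
  obtain ⟨h, rfl⟩ : ∃ h : t ⟶ seqCoproduct X, f = h ≫ p := Triangle.coyoneda_exact₃ _ hZ f hd
  obtain ⟨s, g, rfl⟩ := ht.exists_eq_sum _ h
  clear hd
  rw [Preadditive.sum_comp]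
  induction s using Finset.cons_induction with
  | empty => exact ⟨0, 0, by simp⟩
  | cons j s hj ih =>
    obtain ⟨n, g', hg'⟩ := ih
    obtain ⟨a, ha⟩ := exists_comp_seqι_of_le X φ hZ (le_max_left n j.down) g'
    obtain ⟨b, hb⟩ := exists_comp_seqι_of_le X φ hZ (le_max_right n j.down) (g j)
    refine ⟨_, b + a, ?_⟩
    rw [Finset.sum_cons, hg', ha, Preadditive.add_comp, ← hb, Category.assoc]

end Hocolim

/-! ### Brown functors and their approximation by a homotopy colimit. -/

section Brown

open Pretriangulated

variable {T : Type u} [Category.{v} T] [HasZeroObject T] [Preadditive T] [HasShift T ℤ]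
  [∀ n : ℤ, (shiftFunctor T n).Additive] [Pretriangulated T]

/-- A cohomological functor sending coproducts to products. -/
structure IsBrownFunctor (H : Tᵒᵖ ⥤ AddCommGrpCat.{v}) : Prop where
  additive : H.Additive
  exact (S : Triangle T) (hS : S ∈ distTriang T) (x : H.obj (op S.obj₂))
    (hx : H.map S.mor₁.op x = 0) : ∃ y : H.obj (op S.obj₃), H.map S.mor₂.op y = x
  exists_of {J : Type v} (X : J → T) [HasCoproduct X] (h : ∀ j, H.obj (op (X j))) :
    ∃ x : H.obj (op (∐ X)), ∀ j, H.map (Sigma.ι X j).op x = h j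
  eq_zero {J : Type v} (X : J → T) [HasCoproduct X] (x : H.obj (op (∐ X)))
    (hx : ∀ j, H.map (Sigma.ι X j).op x = 0) : x = 0

/-- A class of objects closed under isomorphisms, cones and coproducts. -/
structure IsLocalizing (P : T → Prop) : Prop where
  of_iso {X Y : T} (e : X ≅ Y) (hX : P X) : P Y
  cone (S : Triangle T) (hS : S ∈ distTriang T) (h₁ : P S.obj₁) (h₂ : P S.obj₂) : P S.obj₃
  coproduct {J : Type v} (X : J → T) [HasCoproduct X] (hX : ∀ j, P (X j)) : P (∐ X)

lemma isBrownFunctor_yoneda (t : T) : IsBrownFunctor (preadditiveYoneda.obj t) where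
  additive := inferInstance
  exact S hS x hx := by
    obtain ⟨y, hy⟩ := S.yoneda_exact₂ hS x hx
    exact ⟨y, hy.symm⟩
  exists_of X _ h := ⟨Sigma.desc h, fun j ↦ Sigma.ι_desc _ _⟩
  eq_zero X _ x hx := Sigma.hom_ext _ _ fun j ↦ (hx j).trans comp_zero.symm

variable {H : Tᵒᵖ ⥤ AddCommGrpCat.{v}}

/-- The compatible family assembles to an element on the coproduct that `1 - shift` kills, so
exactness lifts it to the cone. The lift need not be unique. -/
lemma IsBrownFunctor.exists_of_seq [HasCoproducts.{v} T] (hH : IsBrownFunctor H)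
    (X : ℕ → T) (φ : ∀ n, X n ⟶ X (n + 1)) {Z : T} {p : seqCoproduct X ⟶ Z}
    {d : Z ⟶ (seqCoproduct X)⟦(1 : ℤ)⟧}
    (hZ : Triangle.mk (oneSubShift X φ) p d ∈ distTriang T) (x : ∀ n, H.obj (op (X n)))
    (hx : ∀ n, H.map (φ n).op (x (n + 1)) = x n) :
    ∃ z : H.obj (op Z), ∀ n, H.map (seqι X n ≫ p).op z = x n := by
  have := hH.additive
  obtain ⟨y, hy⟩ := hH.exists_of (fun n : ULift.{v} ℕ ↦ X n.down) (fun n ↦ x n.down)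
  replace hy (n : ℕ) : H.map (seqι X n).op y = x n := hy ⟨n⟩
  obtain ⟨z, hz⟩ : ∃ z : H.obj (op Z), H.map p.op z = y := hH.exact _ hZ y (hH.eq_zero _ _ fun ⟨n⟩ ↦ by
    change H.map (seqι X n).op (H.map (oneSubShift X φ).op y) = 0
    rw [← ConcreteCategory.comp_apply, ← H.map_comp, ← op_comp, seqι_oneSubShift, op_sub,
      H.map_sub]
    change H.map (seqι X n).op y - H.map (φ n ≫ seqι X (n + 1)).op y = 0
    rw [op_comp, H.map_comp, ConcreteCategory.comp_apply, hy, hy, hx, sub_self])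
  refine ⟨z, fun n ↦ ?_⟩
  rw [op_comp, H.map_comp, ConcreteCategory.comp_apply, ← hy]
  exact congr(H.map (seqι X n).op $hz)

/-- The inductive step in the construction of a representing object. -/
lemma IsBrownFunctor.exists_step [HasCoproducts.{v} T] (hH : IsBrownFunctor H) {ι : Type v}
    (S : ι → T) {P : T → Prop} (hP : IsLocalizing P) (hPS : ∀ i, P (S i)) (X : T) (hX : P X)
    (x : H.obj (op X)) :
    ∃ (Y : T) (_ : P Y) (y : H.obj (op Y)) (φ : X ⟶ Y), H.map φ.op y = x ∧
      ∀ (i : ι) (f : S i ⟶ X), H.map f.op x = 0 → f ≫ φ = 0 := by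
  have := hH.additive
  -- All morphisms from generators that kill `x` are made zero at once, by taking the cone of their
  -- sum; `x` extends to it by exactness.
  let J := Σ i : ι, { f : S i ⟶ X // H.map f.op x = 0 }
  let U : J → T := fun j ↦ S j.1
  let a : ∐ U ⟶ X := Sigma.desc fun j ↦ j.2.1
  obtain ⟨Y, φ, d, hY⟩ := distinguished_cocone_triangle a
  obtain ⟨y, hy⟩ := hH.exact _ hY x (hH.eq_zero _ _ fun j ↦ by
    change H.map (Sigma.ι U j).op (H.map a.op x) = 0
    rw [← ConcreteCategory.comp_apply, ← H.map_comp, ← op_comp, Sigma.ι_desc]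
    exact j.2.2)
  refine ⟨Y, hP.cone _ hY (hP.coproduct U fun j ↦ hPS j.1) hX, y, φ, hy, fun i f hf ↦ ?_⟩
  have : f = Sigma.ι U ⟨i, f, hf⟩ ≫ a := by simp [a]
  have h0 : a ≫ φ = 0 := comp_distTriang_mor_zero₁₂ _ hY
  rw [this, Category.assoc, h0, comp_zero]

/-- For any Brown functor `H` there are an object `Z` of the localizing subcategory generated by the
compact objects `S i`, and an element of `H Z`, which represents `H` on the `S i`. -/
lemma IsBrownFunctor.exists_approx [HasCoproducts.{v} T] (hH : IsBrownFunctor H) {ι : Type v}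
    (S : ι → T) (hS : ∀ i, IsCompactObj (S i)) {P : T → Prop} (hP : IsLocalizing P)
    (hPS : ∀ i, P (S i)) :
    ∃ (Z : T) (_ : P Z) (z : H.obj (op Z)), ∀ i,
      Function.Bijective fun f : S i ⟶ Z ↦ H.map f.op z := by
  have := hH.additive
  let A := Σ X : { X : T // P X }, H.obj (op X.1)
  have step (a : A) : ∃ (b : A) (φ : a.1.1 ⟶ b.1.1), H.map φ.op b.2 = a.2 ∧
      ∀ (i : ι) (f : S i ⟶ a.1.1), H.map f.op a.2 = 0 → f ≫ φ = 0 := by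
    obtain ⟨Y, hY, y, φ, h⟩ := hH.exists_step S hP hPS a.1.1 a.1.2 a.2
    exact ⟨⟨⟨Y, hY⟩, y⟩, φ, h⟩
  choose next φ hφ hφ' using step
  -- One copy of `S i` for each element of `H (S i)`: surjectivity is built in at stage zero.
  let J := Σ i : ι, H.obj (op (S i))
  let U : J → T := fun j ↦ S j.1
  obtain ⟨x₀, hx₀⟩ := hH.exists_of U fun j ↦ j.2
  let a₀ : A := ⟨⟨∐ U, hP.coproduct U fun j ↦ hPS j.1⟩, x₀⟩
  let a : ℕ → A := fun n ↦ Nat.rec a₀ (fun _ ↦ next) n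
  let X : ℕ → T := fun n ↦ (a n).1.1
  let ψ (n : ℕ) : X n ⟶ X (n + 1) := φ (a n)
  obtain ⟨Z, p, d, hZ⟩ := distinguished_cocone_triangle (oneSubShift X ψ)
  obtain ⟨z, hz⟩ := hH.exists_of_seq X ψ hZ (fun n ↦ (a n).2) fun n ↦ hφ (a n)
  have hPX : P (seqCoproduct X) := hP.coproduct _ fun n ↦ (a n.down).1.2
  refine ⟨Z, hP.cone _ hZ hPX hPX, z, fun i ↦ ⟨?_, fun h ↦ ?_⟩⟩
  -- By compactness the difference factors through a finite stage, where it kills the chosen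
  -- element; the next transition map makes it zero.
  · intro f f' hff'
    rw [← sub_eq_zero]
    obtain ⟨n, g, hg⟩ := exists_factor_seqι X ψ hZ (hS i) (f - f')
    rw [hg, seqι_comp_eq X ψ hZ, ← Category.assoc, hφ' (a n) i g, zero_comp]
    dsimp only at hff'
    rw [← hz, ← ConcreteCategory.comp_apply, ← H.map_comp, ← op_comp, ← hg, op_sub, H.map_sub]
    change H.map f.op z - H.map f'.op z = 0
    rw [hff', sub_self]
  · refine ⟨Sigma.ι U ⟨i, h⟩ ≫ seqι X 0 ≫ p, ?_⟩
    dsimp only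
    rw [op_comp, H.map_comp, ConcreteCategory.comp_apply, hz]
    exact hx₀ ⟨i, h⟩

end Brown

/-! ### Localizing classes and the five lemma. -/

section Induction

open Pretriangulated

variable {T : Type u} [Category.{v} T]

lemma bijective_of_iso {M M' : T ⥤ AddCommGrpCat.{v}} (τ : M ⟶ M') {X Y : T} (e : X ≅ Y)
    (h : Function.Bijective (τ.app X)) : Function.Bijective (τ.app Y) := by
  rw [← ConcreteCategory.isIso_iff_bijective] at h ⊢
  have : τ.app Y = M.map e.inv ≫ τ.app X ≫ M'.map e.hom := by simp [← Functor.map_comp]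
  rw [this]
  infer_instance

lemma bijective_five {A₁ A₂ A₃ A₄ A₅ B₁ B₂ B₃ B₄ B₅ : AddCommGrpCat.{v}}
    {f₁ : A₁ ⟶ A₂} {f₂ : A₂ ⟶ A₃} {f₃ : A₃ ⟶ A₄} {f₄ : A₄ ⟶ A₅}
    {g₁ : B₁ ⟶ B₂} {g₂ : B₂ ⟶ B₃} {g₃ : B₃ ⟶ B₄} {g₄ : B₄ ⟶ B₅}
    {i₁ : A₁ ⟶ B₁} {i₂ : A₂ ⟶ B₂} {i₃ : A₃ ⟶ B₃} {i₄ : A₄ ⟶ B₄} {i₅ : A₅ ⟶ B₅}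
    (hc₁ : i₁ ≫ g₁ = f₁ ≫ i₂) (hc₂ : i₂ ≫ g₂ = f₂ ≫ i₃) (hc₃ : i₃ ≫ g₃ = f₃ ≫ i₄)
    (hc₄ : i₄ ≫ g₄ = f₄ ≫ i₅)
    (hf₁ : Function.Exact f₁ f₂) (hf₂ : Function.Exact f₂ f₃) (hf₃ : Function.Exact f₃ f₄)
    (hg₁ : Function.Exact g₁ g₂) (hg₂ : Function.Exact g₂ g₃) (hg₃ : Function.Exact g₃ g₄)
    (h₁ : Function.Bijective i₁) (h₂ : Function.Bijective i₂) (h₄ : Function.Bijective i₄)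
    (h₅ : Function.Bijective i₅) : Function.Bijective i₃ :=
  AddMonoidHom.bijective_of_surjective_of_bijective_of_bijective_of_injective
    f₁.hom f₂.hom f₃.hom f₄.hom g₁.hom g₂.hom g₃.hom g₄.hom i₁.hom i₂.hom i₃.hom i₄.hom i₅.hom
    congr(($hc₁).hom) congr(($hc₂).hom) congr(($hc₃).hom) congr(($hc₄).hom)
    hf₁ hf₂ hf₃ hg₁ hg₂ hg₃ h₁.2 h₂ h₄ h₅.1

variable [HasZeroObject T] [Preadditive T] [HasShift T ℤ]
  [∀ n : ℤ, (shiftFunctor T n).Additive] [Pretriangulated T]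

lemma exact_map_distTriang (M : T ⥤ AddCommGrpCat.{v}) [M.IsHomological] (S : Triangle T)
    (hS : S ∈ distTriang T) : Function.Exact (M.map S.mor₁) (M.map S.mor₂) := by
  intro x
  refine ⟨exists_map_eq_of_distTriang M S hS x, ?_⟩
  rintro ⟨y, rfl⟩
  rw [← ConcreteCategory.comp_apply, ← M.map_comp, comp_distTriang_mor_zero₁₂ _ hS]
  simp

lemma IsBrownFunctor.exact_map {H : Tᵒᵖ ⥤ AddCommGrpCat.{v}} (hH : IsBrownFunctor H)
    (S : Triangle T) (hS : S ∈ distTriang T) :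
    Function.Exact (H.map S.mor₂.op) (H.map S.mor₁.op) := by
  have := hH.additive
  intro x
  refine ⟨hH.exact S hS x, ?_⟩
  rintro ⟨y, rfl⟩
  rw [← ConcreteCategory.comp_apply, ← H.map_comp, ← op_comp, comp_distTriang_mor_zero₁₂ _ hS]
  simp

/-- Five lemma for the third object between the first two and their shifts by one; only the shifts
by `0` and `1` enter. -/
lemma bijective_app_obj₃ {M M' : T ⥤ AddCommGrpCat.{v}} [M.IsHomological] [M'.IsHomological]
    (τ : M ⟶ M') (S : Triangle T) (hS : S ∈ distTriang T)
    (h₁ : ∀ n : ℤ, Function.Bijective (τ.app (S.obj₁⟦n⟧)))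
    (h₂ : ∀ n : ℤ, Function.Bijective (τ.app (S.obj₂⟦n⟧))) :
    Function.Bijective (τ.app S.obj₃) := by
  have hS' := rot_of_distTriang _ hS
  have hS'' := rot_of_distTriang _ hS'
  exact bijective_five (τ.naturality _).symm (τ.naturality _).symm (τ.naturality _).symm
    (τ.naturality _).symm (exact_map_distTriang M _ hS) (exact_map_distTriang M _ hS')
    (exact_map_distTriang M _ hS'') (exact_map_distTriang M' _ hS) (exact_map_distTriang M' _ hS')
    (exact_map_distTriang M' _ hS'')
    (bijective_of_iso τ ((shiftFunctorZero T ℤ).app _) (h₁ 0))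
    (bijective_of_iso τ ((shiftFunctorZero T ℤ).app _) (h₂ 0)) (h₁ 1) (h₂ 1)

lemma IsBrownFunctor.bijective_app_obj₃ {H H' : Tᵒᵖ ⥤ AddCommGrpCat.{v}} (hH : IsBrownFunctor H)
    (hH' : IsBrownFunctor H') (τ : H ⟶ H') (S : Triangle T) (hS : S ∈ distTriang T)
    (h₁ : ∀ n : ℤ, Function.Bijective (τ.app (op (S.obj₁⟦n⟧))))
    (h₂ : ∀ n : ℤ, Function.Bijective (τ.app (op (S.obj₂⟦n⟧)))) :
    Function.Bijective (τ.app (op S.obj₃)) := by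
  have hS' := rot_of_distTriang _ hS
  have hS'' := rot_of_distTriang _ hS'
  exact bijective_five (τ.naturality _).symm (τ.naturality _).symm (τ.naturality _).symm
    (τ.naturality _).symm (hH.exact_map _ hS'') (hH.exact_map _ hS') (hH.exact_map _ hS)
    (hH'.exact_map _ hS'') (hH'.exact_map _ hS') (hH'.exact_map _ hS) (h₂ 1) (h₁ 1)
    (bijective_of_iso τ ((shiftFunctorZero T ℤ).symm.app _).op (h₂ 0))
    (bijective_of_iso τ ((shiftFunctorZero T ℤ).symm.app _).op (h₁ 0))

/-- For a natural transformation between Brown functors, the objects all of whose shifts it is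
bijective on form a localizing class. -/
lemma IsBrownFunctor.isLocalizing_bijective {H H' : Tᵒᵖ ⥤ AddCommGrpCat.{v}}
    (hH : IsBrownFunctor H) (hH' : IsBrownFunctor H') (τ : H ⟶ H') [HasCoproducts.{v} T] :
    IsLocalizing fun X : T ↦ ∀ n : ℤ, Function.Bijective (τ.app (op (X⟦n⟧))) where
  of_iso e hX n := bijective_of_iso τ ((shiftFunctor T n).mapIso e).symm.op (hX n)
  cone S hS h₁ h₂ n :=
    hH.bijective_app_obj₃ hH' τ _ (Triangle.shift_distinguished S hS n)
      (fun m ↦ bijective_of_iso τ ((shiftFunctorAdd T n m).app S.obj₁).symm.op (h₁ (n + m)))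
      (fun m ↦ bijective_of_iso τ ((shiftFunctorAdd T n m).app S.obj₂).symm.op (h₂ (n + m)))
  coproduct {J} X _ hX n := by
    have e : (∐ fun j ↦ (X j)⟦n⟧) ≅ (∐ X)⟦n⟧ := PreservesCoproduct.iso (shiftFunctor T n) X |>.symm
    refine bijective_of_iso τ e.symm.op ⟨?_, fun y ↦ ?_⟩
    · rw [injective_iff_map_eq_zero]
      intro x hx
      refine hH.eq_zero _ _ fun j ↦ (injective_iff_map_eq_zero _).1 (hX j n).1 _ ?_
      rw [← ConcreteCategory.comp_apply, τ.naturality, ConcreteCategory.comp_apply, hx, map_zero]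
    · choose x hx using fun j ↦ (hX j n).2 (H'.map (Sigma.ι (fun j ↦ (X j)⟦n⟧) j).op y)
      obtain ⟨x', hx'⟩ := hH.exists_of _ x
      refine ⟨x', ?_⟩
      rw [← sub_eq_zero]
      refine hH'.eq_zero _ _ fun j ↦ ?_
      rw [map_sub, ← ConcreteCategory.comp_apply, ← τ.naturality, ConcreteCategory.comp_apply,
        hx', hx, sub_self]

/-- For a natural transformation between coproduct-preserving homological functors, the objects
all of whose shifts it is bijective on form a localizing class. -/
lemma isLocalizing_bijective [HasCoproducts.{v} T] {M M' : T ⥤ AddCommGrpCat.{v}}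
    [M.IsHomological] [M'.IsHomological] (hM : PreservesCoproducts M)
    (hM' : PreservesCoproducts M') (τ : M ⟶ M') :
    IsLocalizing fun X : T ↦ ∀ n : ℤ, Function.Bijective (τ.app (X⟦n⟧)) where
  of_iso e hX n := bijective_of_iso τ ((shiftFunctor T n).mapIso e) (hX n)
  cone S hS h₁ h₂ n :=
    bijective_app_obj₃ τ _ (Triangle.shift_distinguished S hS n)
      (fun m ↦ bijective_of_iso τ ((shiftFunctorAdd T n m).app S.obj₁) (h₁ (n + m)))
      (fun m ↦ bijective_of_iso τ ((shiftFunctorAdd T n m).app S.obj₂) (h₂ (n + m)))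
  coproduct {J} X _ hX n := by
    classical
    have e : (∐ fun j ↦ (X j)⟦n⟧) ≅ (∐ X)⟦n⟧ := PreservesCoproduct.iso (shiftFunctor T n) X |>.symm
    refine bijective_of_iso τ e ⟨?_, fun y ↦ ?_⟩
    · rw [injective_iff_map_eq_zero]
      intro x hx
      obtain ⟨s, g, rfl⟩ := isSumGenerated_of_preservesCoproducts M hM J _ x
      refine Finset.sum_eq_zero fun j hj ↦ ?_
      have h₁ := map_sigmaπ_map_sigmaι M _ s g j hj
      have h₂ := congr(M'.map (Sigma.π _ j) $hx)
      rw [map_zero, ← ConcreteCategory.comp_apply, ← τ.naturality, ConcreteCategory.comp_apply,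
        h₁] at h₂
      rw [(injective_iff_map_eq_zero _).1 (hX j n).1 _ h₂, map_zero]
    · obtain ⟨s, g, rfl⟩ := isSumGenerated_of_preservesCoproducts M' hM' J _ y
      choose x hx using fun j ↦ (hX j n).2 (g j)
      refine ⟨∑ j ∈ s, M.map (Sigma.ι _ j) (x j), ?_⟩
      rw [map_sum]
      refine Finset.sum_congr rfl fun j _ ↦ ?_
      rw [← ConcreteCategory.comp_apply, τ.naturality, ConcreteCategory.comp_apply, hx]

end Induction

/-! ### Compact generators and Brown representability. -/

section Generators

open Pretriangulated

variable {T : Type u} [Category.{v} T] [HasZeroObject T] [Preadditive T] [HasShift T ℤ]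
  [∀ n : ℤ, (shiftFunctor T n).Additive] [Pretriangulated T]

/-- A compactly generated triangulated category has a family of compact generators stable under
shifts. -/
lemma IsCompactlyGenerated.exists_family (hT : IsCompactlyGenerated T) :
    ∃ (ι : Type v) (S : ι → T), (∀ i, IsCompactObj (S i)) ∧
      (∀ (i : ι) (n : ℤ), ∃ j, Nonempty ((S i)⟦n⟧ ≅ S j)) ∧
      ∀ t : T, (∀ (i : ι) (φ : S i ⟶ t), φ = 0) → IsZero t := by
  obtain ⟨hT₀, ι, G, hG, hG'⟩ := hT
  refine ⟨ι × ℤ, fun i ↦ (G i.1)⟦i.2⟧, fun i ↦ (hG i.1).shift i.2,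
    fun i n ↦ ⟨(i.1, i.2 + n), ⟨((shiftFunctorAdd T i.2 n).app _).symm⟩⟩,
    fun t ht ↦ hG' t fun i φ ↦ ?_⟩
  have e : (G i)⟦(0 : ℤ)⟧ ≅ G i := (shiftFunctorZero T ℤ).app (G i)
  rw [← cancel_epi e.hom, comp_zero]
  exact ht (i, 0) _

/-- The cone receives no nonzero morphism from a generator. Stability of the family under shifts is
needed to control the connecting morphism. -/
lemma isIso_of_bijective_of_family {ι : Type v} {S : ι → T}
    (hS : ∀ (i : ι) (n : ℤ), ∃ j, Nonempty ((S i)⟦n⟧ ≅ S j))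
    (hS' : ∀ t : T, (∀ (i : ι) (φ : S i ⟶ t), φ = 0) → IsZero t) {X Y : T} (f : X ⟶ Y)
    (hf : ∀ i, Function.Bijective fun g : S i ⟶ X ↦ g ≫ f) : IsIso f := by
  obtain ⟨Z, p, d, hZ⟩ := distinguished_cocone_triangle f
  refine (Triangle.isZero₃_iff_isIso₁ _ hZ).1 (hS' _ fun i φ ↦ ?_)
  change S i ⟶ Z at φ
  have hd : φ ≫ d = 0 := by
    let adj : shiftFunctor T (-1 : ℤ) ⊣ shiftFunctor T (1 : ℤ) :=
      (shiftEquiv T (1 : ℤ)).symm.toAdjunction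
    obtain ⟨w, hw⟩ := (adj.homEquiv _ _).surjective (φ ≫ d)
    have hwf : w ≫ f = 0 := by
      apply (adj.homEquiv _ _).injective
      have h31 : d ≫ f⟦(1 : ℤ)⟧' = 0 := comp_distTriang_mor_zero₃₁ _ hZ
      rw [adj.homEquiv_naturality_right, hw, Category.assoc, h31, comp_zero, adj.homEquiv_unit,
        Functor.map_zero, comp_zero]
    obtain ⟨j, ⟨e⟩⟩ := hS i (-1)
    have : e.inv ≫ w = 0 := (hf j).1 (by simp [hwf])
    have hw0 : w = 0 := by rw [← e.hom_inv_id_assoc w, this, comp_zero]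
    rw [← hw, hw0, adj.homEquiv_unit, Functor.map_zero, comp_zero]
  obtain ⟨g, rfl⟩ : ∃ g : S i ⟶ Y, φ = g ≫ p := Triangle.coyoneda_exact₃ _ hZ φ hd
  obtain ⟨g', rfl⟩ := (hf i).2 g
  have h12 : f ≫ p = 0 := comp_distTriang_mor_zero₁₂ _ hZ
  exact (by rw [Category.assoc, h12, comp_zero] : (g' ≫ f) ≫ p = 0)

/-- In a compactly generated category, isomorphisms are detected by compact objects. -/
lemma IsCompactlyGenerated.isIso_of_bijective (hT : IsCompactlyGenerated T) {X Y : T} (f : X ⟶ Y)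
    (hf : ∀ t : T, IsCompactObj t → Function.Bijective fun g : t ⟶ X ↦ g ≫ f) : IsIso f := by
  obtain ⟨ι, S, h₁, h₂, h₃⟩ := hT.exists_family
  exact isIso_of_bijective_of_family h₂ h₃ f fun i ↦ hf _ (h₁ i)

/-- Approximating the functor `Hom(-, X)` from inside the class gives an object of the class and a
morphism to `X` that is bijective on generators, hence an isomorphism. -/
lemma induction_of_family [HasCoproducts.{v} T] {ι : Type v} {S : ι → T}
    (hS₀ : ∀ i, IsCompactObj (S i))
    (hS : ∀ (i : ι) (n : ℤ), ∃ j, Nonempty ((S i)⟦n⟧ ≅ S j))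
    (hS' : ∀ t : T, (∀ (i : ι) (φ : S i ⟶ t), φ = 0) → IsZero t) {P : T → Prop}
    (hP : IsLocalizing P) (hPS : ∀ i, P (S i)) (X : T) : P X := by
  obtain ⟨Z, hZ, z, hz⟩ := (isBrownFunctor_yoneda X).exists_approx S hS₀ hP hPS
  change Z ⟶ X at z
  have := isIso_of_bijective_of_family hS hS' z hz
  exact hP.of_iso (asIso z) hZ

/-- A localizing class containing the compact objects contains everything. -/
lemma IsCompactlyGenerated.induction (hT : IsCompactlyGenerated T) {P : T → Prop}
    (hP : IsLocalizing P) (hPc : ∀ t, IsCompactObj t → P t) (X : T) : P X := by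
  obtain ⟨ι, S, h₁, h₂, h₃⟩ := hT.exists_family
  have := hT.1
  exact induction_of_family h₁ h₂ h₃ hP (fun i ↦ hPc _ (h₁ i)) X

/-- A natural transformation between coproduct-preserving homological functors that is bijective on
compact objects is bijective. -/
lemma IsCompactlyGenerated.bijective_app (hT : IsCompactlyGenerated T)
    {M M' : T ⥤ AddCommGrpCat.{v}} [M.IsHomological] [M'.IsHomological]
    (hM : PreservesCoproducts M) (hM' : PreservesCoproducts M') (τ : M ⟶ M')
    (h : ∀ t, IsCompactObj t → Function.Bijective (τ.app t)) (X : T) :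
    Function.Bijective (τ.app X) := by
  have := hT.1
  exact bijective_of_iso τ ((shiftFunctorZero T ℤ).app X)
    (hT.induction (isLocalizing_bijective hM hM' τ) (fun t ht n ↦ h _ (ht.shift n)) X 0)

/-- The natural transformation from a representable functor given by an element. -/
def yonedaTrans (H : Tᵒᵖ ⥤ AddCommGrpCat.{v}) [H.Additive] {Z : T} (z : H.obj (op Z)) :
    preadditiveYoneda.obj Z ⟶ H where
  app X := AddCommGrpCat.ofHom
    { toFun := fun f : X.unop ⟶ Z ↦ H.map f.op z
      map_zero' := by
        change H.map (0 : op Z ⟶ X) z = 0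
        rw [H.map_zero]
        rfl
      map_add' := fun f g ↦ by
        change H.map (f.op + g.op) z = _
        rw [H.map_add]
        rfl }
  naturality X Y f := by
    have h (g : X.unop ⟶ Z) : H.map (f.unop ≫ g).op z = H.map f (H.map g.op z) := by
      rw [op_comp, H.map_comp, ConcreteCategory.comp_apply]
      rfl
    ext g
    exact h g

/-- **Brown representability.** -/
theorem IsBrownFunctor.exists_representing (hT : IsCompactlyGenerated T)
    {H : Tᵒᵖ ⥤ AddCommGrpCat.{v}} (hH : IsBrownFunctor H) :
    ∃ (Z : T) (z : H.obj (op Z)), ∀ X : T, Function.Bijective fun f : X ⟶ Z ↦ H.map f.op z := by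
  obtain ⟨ι, S, h₁, h₂, h₃⟩ := hT.exists_family
  have := hT.1
  have := hH.additive
  obtain ⟨Z, -, z, hz⟩ := hH.exists_approx S h₁ (P := fun _ ↦ True)
    ⟨fun _ _ ↦ trivial, fun _ _ _ _ ↦ trivial, fun _ _ _ ↦ trivial⟩ (fun _ ↦ trivial)
  refine ⟨Z, z, fun X ↦ ?_⟩
  -- The transformation given by `z` is bijective on generators, hence on the localizing class they
  -- generate, which is everything.
  have := induction_of_family h₁ h₂ h₃
    ((isBrownFunctor_yoneda Z).isLocalizing_bijective hH (yonedaTrans H z)) (fun i n ↦ by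
      obtain ⟨j, ⟨e⟩⟩ := h₂ i n
      exact bijective_of_iso (yonedaTrans H z) e.op (hz j)) X 0
  exact bijective_of_iso (yonedaTrans H z) ((shiftFunctorZero T ℤ).symm.app X).op this

end Generators

/-! ### Adjoints and preservation of coproducts. -/

section Adjoints

open Pretriangulated

variable {T : Type u₁} [Category.{v} T] [HasZeroObject T] [Preadditive T] [HasShift T ℤ]
  [∀ n : ℤ, (shiftFunctor T n).Additive] [Pretriangulated T]
  {T' : Type u₂} [Category.{v} T'] [HasZeroObject T'] [Preadditive T'] [HasShift T' ℤ]
  [∀ n : ℤ, (shiftFunctor T' n).Additive] [Pretriangulated T']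

/-- A representing object of this functor is the value at `t` of a right adjoint of `A`. -/
lemma isBrownFunctor_comp_yoneda (A : T ⥤ T') [A.CommShift ℤ] [A.IsTriangulated]
    (hA : PreservesCoproducts A) (t : T') :
    IsBrownFunctor (A.op ⋙ preadditiveYoneda.obj t) where
  additive := inferInstance
  exact S hS x hx := by
    obtain ⟨y, hy⟩ := Triangle.yoneda_exact₂ _ (A.map_distinguished S hS) x hx
    exact ⟨y, hy.symm⟩
  exists_of {J} X _ h := by
    have := hA J
    refine ⟨Cofan.IsColimit.desc (isColimitCofanMkObjOfIsColimit A _ _ (coproductIsCoproduct X)) h,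
      fun j ↦ ?_⟩
    exact Cofan.IsColimit.fac (isColimitCofanMkObjOfIsColimit A _ _ (coproductIsCoproduct X)) h j
  eq_zero {J} X _ x hx := by
    have := hA J
    exact Cofan.IsColimit.hom_ext (isColimitCofanMkObjOfIsColimit A _ _ (coproductIsCoproduct X))
      _ _ fun j ↦ (hx j).trans comp_zero.symm

/-- A coproduct-preserving triangulated functor on a compactly generated category has a right
adjoint. -/
theorem isLeftAdjoint_of_preservesCoproducts (hT : IsCompactlyGenerated T) (A : T ⥤ T')
    [A.CommShift ℤ] [A.IsTriangulated] (hA : PreservesCoproducts A) : A.IsLeftAdjoint := by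
  have (t : T') : ∃ (Z : T) (z : A.obj Z ⟶ t), ∀ X : T,
      Function.Bijective fun f : X ⟶ Z ↦ A.map f ≫ z :=
    (isBrownFunctor_comp_yoneda A hA t).exists_representing hT
  choose Z z hz using this
  exact (Adjunction.adjunctionOfEquivRight (F := A) (G_obj := Z)
    (fun X t ↦ (Equiv.ofBijective _ (hz t X)).symm) (fun X' X t f g ↦ by
      rw [Equiv.symm_apply_eq]
      obtain ⟨g', rfl⟩ := (Equiv.ofBijective _ (hz t X)).surjective g
      simp)).isLeftAdjoint

/-- The right adjoint of a functor preserving compact objects preserves coproducts. -/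
lemma preservesCoproducts_of_adjunction (hT : IsCompactlyGenerated T) [HasCoproducts.{v} T']
    {A : T ⥤ T'} {B : T' ⥤ T} [B.Additive] (adj : A ⊣ B)
    (hA : ∀ t, IsCompactObj t → IsCompactObj (A.obj t)) : PreservesCoproducts B := by
  classical
  intro J
  have := hT.1
  have (X : J → T') : PreservesColimit (Discrete.functor X) B := by
    have : IsIso (sigmaComparison B X) := hT.isIso_of_bijective _ fun t ht ↦ by
      have key (s : Finset J) (g : ∀ j, t ⟶ B.obj (X j)) :
          (∑ j ∈ s, g j ≫ Sigma.ι (fun j ↦ B.obj (X j)) j) ≫ sigmaComparison B X =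
            ∑ j ∈ s, g j ≫ B.map (Sigma.ι X j) := by
        simp [Preadditive.sum_comp]
      refine ⟨?_, fun y ↦ ?_⟩
      · change Function.Injective (Preadditive.rightComp t (sigmaComparison B X))
        rw [injective_iff_map_eq_zero]
        intro x hx
        change x ≫ _ = 0 at hx
        obtain ⟨s, g, rfl⟩ := ht.exists_eq_sum _ x
        rw [key] at hx
        refine Finset.sum_eq_zero fun j hj ↦ ?_
        have h := map_sigmaπ_map_sigmaι (B ⋙ preadditiveCoyoneda.obj (op t)) X s g j hj
        have h' : (∑ j ∈ s, g j ≫ B.map (Sigma.ι X j)) ≫ B.map (Sigma.π X j) = g j := h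
        rw [hx, zero_comp] at h'
        rw [← h', zero_comp]
      -- The transpose has compact source `A.obj t`, so it is a finite sum, and transposing back
      -- gives the preimage.
      · obtain ⟨s, g, hg⟩ := (hA t ht).exists_eq_sum X ((adj.homEquiv _ _).symm y)
        refine ⟨∑ j ∈ s, adj.homEquiv _ _ (g j) ≫ Sigma.ι (fun j ↦ B.obj (X j)) j, ?_⟩
        dsimp only
        rw [key, ← (adj.homEquiv _ _).apply_symm_apply y, hg]
        simp [adj.homEquiv_unit, Functor.map_sum, Preadditive.comp_sum]
    exact PreservesCoproduct.of_iso_comparison B X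
  exact preservesColimitsOfShape_of_discrete B

end Adjoints

/-! ### Products and split idempotents. -/

section Products

open Pretriangulated

variable {T : Type u} [Category.{v} T] [HasZeroObject T] [Preadditive T] [HasShift T ℤ]
  [∀ n : ℤ, (shiftFunctor T n).Additive] [Pretriangulated T]

/-- The functor sending `X` to the group of families of morphisms from `X` to the `Y j`. -/
def homFamily {J : Type v} (Y : J → T) : Tᵒᵖ ⥤ AddCommGrpCat.{v} where
  obj X := AddCommGrpCat.of (∀ j, X.unop ⟶ Y j)
  map f := AddCommGrpCat.ofHom
    { toFun := fun g j ↦ f.unop ≫ g j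
      map_zero' := by ext; simp
      map_add' := fun _ _ ↦ by ext; simp }

/-- A representing object of this functor is a product of the `Y j`. -/
lemma isBrownFunctor_homFamily {J : Type v} (Y : J → T) : IsBrownFunctor (homFamily Y) where
  additive := ⟨fun {X X' f g} ↦ by
    ext h
    exact funext fun j ↦ Preadditive.add_comp _ _ _ f.unop g.unop (h j)⟩
  exact S hS x hx := by
    choose y hy using fun j ↦ S.yoneda_exact₂ hS (x j) (congr_fun hx j)
    exact ⟨y, funext fun j ↦ (hy j).symm⟩
  exists_of X _ h := ⟨fun j ↦ Sigma.desc fun i ↦ h i j, fun i ↦ funext fun j ↦ Sigma.ι_desc _ _⟩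
  eq_zero X _ x hx := funext fun j ↦ Sigma.hom_ext _ _ fun i ↦
    (congr_fun (hx i) j).trans (comp_zero (f := Sigma.ι X i)).symm

/-- A compactly generated triangulated category has products. -/
lemma IsCompactlyGenerated.hasProducts (hT : IsCompactlyGenerated T) : HasProducts.{v} T :=
  hasProducts_of_limit_fans (fun {J} Y ↦ Fan.mk
      ((isBrownFunctor_homFamily Y).exists_representing hT).choose
      ((isBrownFunctor_homFamily Y).exists_representing hT).choose_spec.choose) (fun {J} Y ↦ by
    have h := ((isBrownFunctor_homFamily Y).exists_representing hT).choose_spec.choose_spec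
    exact Fan.IsLimit.mk _ (fun s ↦ ((h s.pt).2 s.proj).choose)
      (fun s j ↦ congr_fun ((h s.pt).2 s.proj).choose_spec j)
      (fun s m hm ↦ (h s.pt).1 ((funext hm).trans ((h s.pt).2 s.proj).choose_spec.symm)))

end Products

section Splitting

open Pretriangulated

variable {T : Type u} [Category.{v} T] [HasZeroObject T] [Preadditive T] [HasShift T ℤ]
  [∀ n : ℤ, (shiftFunctor T n).Additive] [Pretriangulated T]

/-- Idempotents split in a compactly generated triangulated category. -/
lemma IsCompactlyGenerated.exists_splitting (hT : IsCompactlyGenerated T) {X : T} (e : X ⟶ X)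
    (he : e ≫ e = e) : ∃ (Y : T) (s : Y ⟶ X) (p : X ⟶ Y), s ≫ p = 𝟙 Y ∧ p ≫ s = e := by
  have := hT.1
  -- The splitting is the homotopy colimit of the sequence with all transition maps `e`.
  obtain ⟨Z, q, d, hZ⟩ := distinguished_cocone_triangle (oneSubShift (fun _ ↦ X) (fun _ ↦ e))
  let p (n : ℕ) : X ⟶ Z := seqι (fun _ ↦ X) n ≫ q
  have hp (n : ℕ) : p n = e ≫ p (n + 1) := seqι_comp_eq (fun _ ↦ X) (fun _ ↦ e) hZ n
  have hep (n : ℕ) : e ≫ p n = p n := by rw [hp n, reassoc_of% he]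
  have hp₀ (n : ℕ) : p n = p 0 := by
    induction n with
    | zero => rfl
    | succ n h => rw [← h, hp n, hep]
  let a : seqCoproduct (fun _ : ℕ ↦ X) ⟶ X := Limits.Sigma.desc fun _ ↦ e
  have ha (n : ℕ) : seqι (fun _ : ℕ ↦ X) n ≫ a = e := Limits.Sigma.ι_desc _ _
  have ha₀ : oneSubShift (fun _ ↦ X) (fun _ ↦ e) ≫ a = 0 := Sigma.hom_ext _ _ fun ⟨n⟩ ↦ by
    change seqι (fun _ : ℕ ↦ X) n ≫ _ = seqι (fun _ : ℕ ↦ X) n ≫ 0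
    rw [reassoc_of% seqι_oneSubShift (fun _ : ℕ ↦ X) (fun _ ↦ e) n, Preadditive.sub_comp,
      Category.assoc, ha, ha, he, sub_self, comp_zero]
  obtain ⟨r, hr⟩ : ∃ r : Z ⟶ X, a = q ≫ r := Triangle.yoneda_exact₂ _ hZ a ha₀
  have hpr : p 0 ≫ r = e := by
    dsimp only [p]
    rw [Category.assoc, ← hr, ha]
  have hu {t : T} (ht : IsCompactObj t) (f : t ⟶ Z) : f ≫ r ≫ p 0 = f := by
    obtain ⟨n, g, hg⟩ := exists_factor_seqι (fun _ ↦ X) (fun _ ↦ e) hZ ht f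
    change f = g ≫ p n at hg
    rw [hg, hp₀, Category.assoc, reassoc_of% hpr, hep]
  -- The endomorphism `r ≫ p 0` fixes every morphism from a compact object; this makes it
  -- invertible, and its inverse corrects the section.
  have : IsIso (r ≫ p 0) := hT.isIso_of_bijective _ fun t ht ↦
    ⟨fun f g h ↦ by rw [← hu ht f, ← hu ht g]; exact h, fun f ↦ ⟨f, hu ht f⟩⟩
  refine ⟨Z, inv (r ≫ p 0) ≫ r, p 0, by simp, ?_⟩
  have h : p 0 ≫ inv (r ≫ p 0) = p 0 := by rw [IsIso.comp_inv_eq, reassoc_of% hpr, hep]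
  rw [reassoc_of% h, hpr]

end Splitting

/-! ### Essentially small classes of compact objects. -/

section Thick

open Pretriangulated ZeroObject

variable {T : Type u} [Category.{v} T] [HasZeroObject T] [Preadditive T] [HasShift T ℤ]
  [∀ n : ℤ, (shiftFunctor T n).Additive] [Pretriangulated T]

/-- A class of compact objects closed under shifts and cones. -/
structure IsFiniteClass (Q : T → Prop) : Prop where
  isCompactObj {X : T} (hX : Q X) : IsCompactObj X
  zero : Q 0
  of_iso {X Y : T} (e : X ≅ Y) (hX : Q X) : Q Y
  shift {X : T} (hX : Q X) (n : ℤ) : Q (X⟦n⟧)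
  cone (S : Triangle T) (hS : S ∈ distTriang T) (h₁ : Q S.obj₁) (h₂ : Q S.obj₂) : Q S.obj₃

namespace IsFiniteClass

variable {Q : T → Prop}

lemma fiber (hQ : IsFiniteClass Q) (S : Triangle T) (hS : S ∈ distTriang T) (h₂ : Q S.obj₂)
    (h₃ : Q S.obj₃) : Q S.obj₁ := by
  have h : Q (S.obj₁⟦(1 : ℤ)⟧) := hQ.cone _ (rot_of_distTriang _ hS) h₂ h₃
  exact hQ.of_iso ((shiftEquiv T (1 : ℤ)).unitIso.app S.obj₁).symm (hQ.shift h (-1))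

lemma biprod (hQ : IsFiniteClass Q) {X Y : T} (hX : Q X) (hY : Q Y) : Q (X ⊞ Y) :=
  hQ.cone _ (inv_rot_of_distTriang _ (binaryBiproductTriangle_distinguished X Y))
    (hQ.shift hY (-1)) hX

end IsFiniteClass

/-- Adjoin the shifts of the members, and the cones of the morphisms between members, to a family of
objects. -/
def coneStep (A : Σ κ : Type v, κ → T) : Σ κ : Type v, κ → T :=
  ⟨(A.1 × ℤ) ⊕ (Σ a b : A.1, A.2 a ⟶ A.2 b), Sum.elim (fun p ↦ (A.2 p.1)⟦p.2⟧)
    (fun p ↦ (distinguished_cocone_triangle p.2.2).choose)⟩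

/-- The objects built in `n` steps from the members of a family. -/
def coneLevel (A : Σ κ : Type v, κ → T) : ℕ → Σ κ : Type v, κ → T
  | 0 => A
  | n + 1 => coneStep (coneLevel A n)

lemma coneLevel_shift (A : Σ κ : Type v, κ → T) (n : ℕ) (a : (coneLevel A n).1) (m : ℤ) :
    ∃ b : (coneLevel A (n + 1)).1, (coneLevel A (n + 1)).2 b = ((coneLevel A n).2 a)⟦m⟧ :=
  ⟨Sum.inl (a, m), rfl⟩

/-- The shift by `0` embeds each level into the next, up to isomorphism. -/
lemma coneLevel_mono (A : Σ κ : Type v, κ → T) {n m : ℕ} (h : n ≤ m) (a : (coneLevel A n).1) :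
    ∃ b : (coneLevel A m).1, Nonempty ((coneLevel A m).2 b ≅ (coneLevel A n).2 a) := by
  induction m, h using Nat.le_induction with
  | base => exact ⟨a, ⟨Iso.refl _⟩⟩
  | succ m _ ih =>
    obtain ⟨b, ⟨e⟩⟩ := ih
    obtain ⟨c, hc⟩ := coneLevel_shift A m b 0
    exact ⟨c, ⟨eqToIso hc ≪≫ (shiftFunctorZero T ℤ).app _ ≪≫ e⟩⟩

lemma coneLevel_cone (A : Σ κ : Type v, κ → T) (n : ℕ) (a b : (coneLevel A n).1) (S : Triangle T)
    (hS : S ∈ distTriang T) (e₁ : (coneLevel A n).2 a ≅ S.obj₁)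
    (e₂ : (coneLevel A n).2 b ≅ S.obj₂) :
    ∃ c : (coneLevel A (n + 1)).1, Nonempty ((coneLevel A (n + 1)).2 c ≅ S.obj₃) := by
  let f := e₁.hom ≫ S.mor₁ ≫ e₂.inv
  obtain ⟨g, d, h⟩ := (distinguished_cocone_triangle f).choose_spec
  obtain ⟨e, -⟩ := exists_iso_of_arrow_iso _ _ h hS
    (Arrow.isoMk (f := Arrow.mk f) (g := Arrow.mk S.mor₁) e₁ e₂ (by simp [f]))
  exact ⟨Sum.inr ⟨a, b, f⟩, ⟨Triangle.π₃.mapIso e⟩⟩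

/-- A family of compact objects is contained in an essentially small class of compact objects closed
under shifts and cones. -/
lemma exists_isFiniteClass [HasCoproducts.{v} T] {ι : Type v} (S : ι → T)
    (hS : ∀ i, IsCompactObj (S i)) :
    ∃ Q : T → Prop, IsFiniteClass Q ∧ (∀ i, Q (S i)) ∧
      ∃ (κ : Type v) (k : κ → T), (∀ a, Q (k a)) ∧ ∀ X, Q X → ∃ a, Nonempty (k a ≅ X) := by
  -- The extra index adjoins the zero object.
  let A : Σ κ : Type v, κ → T := ⟨Option ι, fun i ↦ i.elim 0 S⟩
  have hA (n : ℕ) (a : (coneLevel A n).1) : IsCompactObj ((coneLevel A n).2 a) := by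
    induction n with
    | zero =>
      match a with
      | none => exact isCompactObj_of_exists_eq_sum fun J X f ↦
          ⟨∅, fun _ ↦ 0, (isZero_zero T).eq_of_src _ _⟩
      | some i => exact hS i
    | succ n ih =>
      match a with
      | Sum.inl p => exact (ih p.1).shift p.2
      | Sum.inr p =>
        obtain ⟨g, d, h⟩ := (distinguished_cocone_triangle p.2.2).choose_spec
        exact IsCompactObj.cone _ h (ih _) (ih _)
  refine ⟨fun X ↦ ∃ (n : ℕ) (a : (coneLevel A n).1), Nonempty ((coneLevel A n).2 a ≅ X),
    ⟨?_, ?_, ?_, ?_, ?_⟩, fun i ↦ ⟨0, some i, ⟨Iso.refl _⟩⟩, Σ n, (coneLevel A n).1,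
    fun a ↦ (coneLevel A a.1).2 a.2, fun a ↦ ⟨a.1, a.2, ⟨Iso.refl _⟩⟩, ?_⟩
  · rintro X ⟨n, a, ⟨e⟩⟩
    exact (hA n a).of_iso e
  · exact ⟨0, none, ⟨Iso.refl _⟩⟩
  · rintro X Y e ⟨n, a, ⟨e'⟩⟩
    exact ⟨n, a, ⟨e' ≪≫ e⟩⟩
  · rintro X ⟨n, a, ⟨e⟩⟩ m
    obtain ⟨b, hb⟩ := coneLevel_shift A n a m
    exact ⟨n + 1, b, ⟨eqToIso hb ≪≫ (shiftFunctor T m).mapIso e⟩⟩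
  · rintro S hS ⟨n, a, ⟨e⟩⟩ ⟨n', a', ⟨e'⟩⟩
    obtain ⟨b, ⟨i⟩⟩ := coneLevel_mono A (le_max_left n n') a
    obtain ⟨b', ⟨i'⟩⟩ := coneLevel_mono A (le_max_right n n') a'
    exact ⟨_, coneLevel_cone A _ b b' S hS (i ≪≫ e) (i' ≪≫ e')⟩
  · rintro X ⟨n, a, ⟨e⟩⟩
    exact ⟨⟨n, a⟩, ⟨e⟩⟩

end Thick

/-! ### Homological functors as colimits over compact objects. -/

section Finitary

open Pretriangulated ZeroObject

variable {T : Type u} [Category.{v} T] [HasZeroObject T] [Preadditive T] [HasShift T ℤ]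
  [∀ n : ℤ, (shiftFunctor T n).Additive] [Pretriangulated T]

/-- The element `m` of `M X` comes from an object in `Q`. -/
def ComesFrom (M : T ⥤ AddCommGrpCat.{v}) (Q : T → Prop) {X : T} (m : M.obj X) : Prop :=
  ∃ (x : T) (_ : Q x) (f : x ⟶ X) (k : M.obj x), M.map f k = m

/-- `M X` is the colimit of the `M x`, over the objects `x` over `X` that are in `Q`. -/
structure IsFinitary (M : T ⥤ AddCommGrpCat.{v}) (Q : T → Prop) (X : T) : Prop where
  comesFrom (m : M.obj X) : ComesFrom M Q m
  factors {x : T} (hx : Q x) (f : x ⟶ X) (m : M.obj x) (hm : M.map f m = 0) :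
    ∃ (x' : T) (_ : Q x') (g : x ⟶ x') (h : x' ⟶ X), g ≫ h = f ∧ M.map g m = 0

variable {M : T ⥤ AddCommGrpCat.{v}} {Q : T → Prop}

lemma ComesFrom.map {X Y : T} {m : M.obj X} (h : ComesFrom M Q m) (f : X ⟶ Y) :
    ComesFrom M Q (M.map f m) := by
  obtain ⟨x, hx, g, m', rfl⟩ := h
  exact ⟨x, hx, g ≫ f, m', by simp⟩

lemma ComesFrom.zero (hQ : IsFiniteClass Q) (X : T) : ComesFrom M Q (0 : M.obj X) :=
  ⟨0, hQ.zero, 0, 0, by simp⟩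

lemma ComesFrom.add (hQ : IsFiniteClass Q) {X : T} {m m' : M.obj X} (h : ComesFrom M Q m)
    (h' : ComesFrom M Q m') : ComesFrom M Q (m + m') := by
  obtain ⟨x, hx, g, m, rfl⟩ := h
  obtain ⟨x', hx', g', m', rfl⟩ := h'
  refine ⟨x ⊞ x', hQ.biprod hx hx', biprod.desc g g', M.map biprod.inl m + M.map biprod.inr m', ?_⟩
  rw [map_add, ← ConcreteCategory.comp_apply, ← ConcreteCategory.comp_apply, ← M.map_comp,
    ← M.map_comp, biprod.inl_desc, biprod.inr_desc]

lemma IsFinitary.of_iso {X Y : T} (hX : IsFinitary M Q X) (e : X ≅ Y) : IsFinitary M Q Y where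
  comesFrom m := by
    have := (hX.comesFrom (M.map e.inv m)).map e.hom
    rwa [← ConcreteCategory.comp_apply, ← M.map_comp, e.inv_hom_id, M.map_id] at this
  factors hx f m hm := by
    obtain ⟨x', hx', g, h, hgh, hg⟩ := hX.factors hx (f ≫ e.inv) m (by simp [hm])
    exact ⟨x', hx', g, h ≫ e.hom, by rw [← Category.assoc, hgh]; simp, hg⟩

lemma isFinitary_of_mem {X : T} (hX : Q X) : IsFinitary M Q X where
  comesFrom m := ⟨X, hX, 𝟙 X, m, by simp⟩
  factors _ f _ hm := ⟨X, hX, f, 𝟙 X, by simp, hm⟩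

variable [M.IsHomological]

/-- The image of `m` in the third object comes from some `z` in the class. Passing to the fiber of a
suitable morphism `z ⟶ x` lifts it to the second object, and the error comes from the first. -/
lemma IsFinitary.comesFrom_obj₂ (hQ : IsFiniteClass Q) (S : Triangle T) (hS : S ∈ distTriang T)
    (h₁ : IsFinitary M Q S.obj₁) (h₁' : IsFinitary M Q (S.obj₁⟦(1 : ℤ)⟧))
    (h₃ : IsFinitary M Q S.obj₃) (m : M.obj S.obj₂) : ComesFrom M Q m := by
  obtain ⟨z, hz, f, mz, hf⟩ := h₃.comesFrom (M.map S.mor₂ m)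
  obtain ⟨x, hx, g, h, hgh, hg⟩ := h₁'.factors hz (f ≫ S.mor₃) mz (by
    rw [M.map_comp, ConcreteCategory.comp_apply, hf, ← ConcreteCategory.comp_apply, ← M.map_comp,
      comp_distTriang_mor_zero₂₃ _ hS]
    simp)
  obtain ⟨y, a, d, hy⟩ := distinguished_cocone_triangle₁ g
  obtain ⟨my, hmy⟩ : ∃ my : M.obj y, M.map a my = mz := exists_map_eq_of_distTriang M _ hy mz hg
  obtain ⟨fy, hfy, -⟩ := complete_distinguished_triangle_morphism₁ _ _ hy
    (rot_of_distTriang _ hS) f h hgh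
  change y ⟶ S.obj₂ at fy
  change a ≫ f = fy ≫ S.mor₂ at hfy
  obtain ⟨mx, hmx⟩ := exists_map_eq_of_distTriang M _ hS (m - M.map fy my) (by
    rw [map_sub, ← ConcreteCategory.comp_apply, ← M.map_comp, ← hfy, M.map_comp,
      ConcreteCategory.comp_apply, hmy, hf, sub_self])
  rw [← sub_add_cancel m (M.map fy my), ← hmx]
  exact ((h₁.comesFrom mx).map _).add hQ ⟨y, hQ.fiber _ hy hz hx, fy, my, rfl⟩

/-- Killing `m` in the third object replaces `y` by a fiber `w` that maps to the first. There the
lift of `m` vanishes only up to an element of the desuspended third object, which a further object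
`v` of the class absorbs. -/
lemma IsFinitary.factors_obj₂ (hQ : IsFiniteClass Q) (S : Triangle T) (hS : S ∈ distTriang T)
    (h₁ : IsFinitary M Q S.obj₁) (h₃ : IsFinitary M Q S.obj₃)
    (h₃' : IsFinitary M Q (S.obj₃⟦(-1 : ℤ)⟧)) {y : T} (hy : Q y) (f : y ⟶ S.obj₂) (m : M.obj y)
    (hm : M.map f m = 0) :
    ∃ (y' : T) (_ : Q y') (g : y ⟶ y') (h : y' ⟶ S.obj₂), g ≫ h = f ∧ M.map g m = 0 := by
  obtain ⟨z, hz, g, h, hgh, hg⟩ := h₃.factors hy (f ≫ S.mor₂) m (by simp [hm])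
  obtain ⟨w, i, d, hw⟩ := distinguished_cocone_triangle₁ g
  obtain ⟨mw, hmw⟩ : ∃ mw : M.obj w, M.map i mw = m := exists_map_eq_of_distTriang M _ hw m hg
  obtain ⟨fw, hfw, -⟩ := complete_distinguished_triangle_morphism₁ _ _ hw hS f h hgh
  change w ⟶ S.obj₁ at fw
  change i ≫ f = fw ≫ S.mor₁ at hfw
  have hQw : Q w := hQ.fiber _ hw hy hz
  have hS' := inv_rot_of_distTriang _ hS
  let j : S.obj₃⟦(-1 : ℤ)⟧ ⟶ S.obj₁ := S.invRotate.mor₁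
  have hj : j ≫ S.mor₁ = 0 := comp_distTriang_mor_zero₁₂ _ hS'
  obtain ⟨m₂, hm₂⟩ : ∃ m₂ : M.obj (S.obj₃⟦(-1 : ℤ)⟧), M.map j m₂ = M.map fw mw :=
    exists_map_eq_of_distTriang M _ hS' (M.map fw mw) (by
      change M.map S.mor₁ (M.map fw mw) = 0
      rw [← ConcreteCategory.comp_apply, ← M.map_comp, ← hfw, M.map_comp,
        ConcreteCategory.comp_apply, hmw, hm])
  obtain ⟨v, hv, k, mv, hk⟩ := h₃'.comesFrom m₂
  let μ : M.obj (w ⊞ v) := M.map biprod.inl mw + M.map biprod.inr mv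
  obtain ⟨x, hx, p, q, hpq, hp⟩ := h₁.factors (hQ.biprod hQw hv) (biprod.desc fw (-(k ≫ j))) μ (by
    rw [map_add, ← ConcreteCategory.comp_apply, ← ConcreteCategory.comp_apply, ← M.map_comp,
      ← M.map_comp, biprod.inl_desc, biprod.inr_desc, M.map_neg, M.map_comp]
    change M.map fw mw + -(M.map j (M.map k mv)) = 0
    rw [hk, hm₂, add_neg_cancel])
  -- The cone of `a` is a homotopy pushout of `y` and `x` under `w ⊞ v`: in it the image of `m`
  -- equals that of `M.map p μ`, which is zero.
  let a : w ⊞ v ⟶ y ⊞ x := biprod.fst ≫ i ≫ biprod.inl - p ≫ biprod.inr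
  let b : y ⊞ x ⟶ S.obj₂ := biprod.desc f (q ≫ S.mor₁)
  have hab : a ≫ b = 0 := by
    simp only [a, b, Preadditive.sub_comp, Category.assoc, biprod.inl_desc, biprod.inr_desc]
    rw [reassoc_of% hpq, hfw]
    apply biprod.hom_ext' <;> simp [hj]
  obtain ⟨y', c, d', hy'⟩ := distinguished_cocone_triangle a
  obtain ⟨b', hb'⟩ : ∃ b' : y' ⟶ S.obj₂, b = c ≫ b' := Triangle.yoneda_exact₂ _ hy' b hab
  have hac : a ≫ c = 0 := comp_distTriang_mor_zero₁₂ _ hy'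
  refine ⟨y', hQ.cone _ hy' (hQ.biprod hQw hv) (hQ.biprod hy hx), biprod.inl ≫ c, b', ?_, ?_⟩
  · rw [Category.assoc, ← hb', biprod.inl_desc]
  · have h₀ : M.map (biprod.fst ≫ i ≫ biprod.inl ≫ c) μ = M.map (p ≫ biprod.inr ≫ c) μ := by
      have : biprod.fst ≫ i ≫ biprod.inl ≫ c = p ≫ biprod.inr ≫ c := by
        rw [← sub_eq_zero, ← hac]
        simp [a]
      rw [this]
    rw [M.map_comp p, ConcreteCategory.comp_apply, hp, map_zero, M.map_comp,
      ConcreteCategory.comp_apply, map_add, ← ConcreteCategory.comp_apply,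
      ← ConcreteCategory.comp_apply, ← M.map_comp, ← M.map_comp, biprod.inl_fst, biprod.inr_fst]
      at h₀
    simpa [← hmw] using h₀

lemma IsFinitary.obj₂ (hQ : IsFiniteClass Q) (S : Triangle T) (hS : S ∈ distTriang T)
    (h₁ : IsFinitary M Q S.obj₁) (h₁' : IsFinitary M Q (S.obj₁⟦(1 : ℤ)⟧))
    (h₃ : IsFinitary M Q S.obj₃) (h₃' : IsFinitary M Q (S.obj₃⟦(-1 : ℤ)⟧)) :
    IsFinitary M Q S.obj₂ :=
  ⟨IsFinitary.comesFrom_obj₂ hQ S hS h₁ h₁' h₃, IsFinitary.factors_obj₂ hQ S hS h₁ h₃ h₃'⟩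

lemma IsFinitary.coproduct [HasCoproducts.{v} T] (hQ : IsFiniteClass Q)
    (hM : PreservesCoproducts M) {J : Type v} (X : J → T) (hX : ∀ j, IsFinitary M Q (X j)) :
    IsFinitary M Q (∐ X) where
  comesFrom m := by
    obtain ⟨s, g, rfl⟩ := isSumGenerated_of_preservesCoproducts M hM J X m
    refine Finset.sum_induction _ (ComesFrom M Q) (fun _ _ h h' ↦ h.add hQ h')
      (ComesFrom.zero hQ _) fun j _ ↦ ((hX j).comesFrom (g j)).map _
  factors {x} hx f m hm := by
    classical
    obtain ⟨s, g, rfl⟩ := (hQ.isCompactObj hx).exists_eq_sum X f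
    have hg (j : J) (hj : j ∈ s) : M.map (g j) m = 0 := by
      rw [← sum_comp_sigmaι_π X s g j hj, M.map_comp, ConcreteCategory.comp_apply, hm, map_zero]
    clear hm
    induction s using Finset.cons_induction with
    | empty => exact ⟨0, hQ.zero, 0, 0, by simp, by simp⟩
    | cons j s hj ih =>
      obtain ⟨x', hx', a, b, hab, ha⟩ := ih fun k hk ↦ hg k (Finset.mem_cons_of_mem hk)
      obtain ⟨x'', hx'', a', b', hab', ha'⟩ :=
        (hX j).factors hx (g j) m (hg j (Finset.mem_cons_self j s))
      refine ⟨x' ⊞ x'', hQ.biprod hx' hx'', biprod.lift a a', biprod.desc b (b' ≫ Sigma.ι X j),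
        ?_, ?_⟩
      · rw [biprod.lift_desc, hab, reassoc_of% hab', Finset.sum_cons, add_comm]
      · rw [biprod.lift_eq, M.map_add]
        change M.map (a ≫ biprod.inl) m + M.map (a' ≫ biprod.inr) m = 0
        simp [ha, ha']

/-- The cone is the middle object of the rotated triangle, so the two-out-of-three property for
middle objects applies once all shifts are included. -/
lemma isLocalizing_isFinitary [HasCoproducts.{v} T] (hQ : IsFiniteClass Q)
    (hM : PreservesCoproducts M) :
    IsLocalizing fun X : T ↦ ∀ n : ℤ, IsFinitary M Q (X⟦n⟧) where
  of_iso e hX n := (hX n).of_iso ((shiftFunctor T n).mapIso e)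
  cone S hS h₁ h₂ n := by
    have h := rot_of_distTriang _ (Triangle.shift_distinguished S hS n)
    refine IsFinitary.obj₂ hQ _ h (h₂ n)
      ((h₂ (n + 1)).of_iso ((shiftFunctorAdd T n 1).app _))
      ((h₁ (n + 1)).of_iso ((shiftFunctorAdd T n 1).app _))
      ((h₁ n).of_iso ((shiftEquiv T (1 : ℤ)).unitIso.app _))
  coproduct {J} X _ hX n :=
    (IsFinitary.coproduct hQ hM _ fun j ↦ hX j n).of_iso
      (PreservesCoproduct.iso (shiftFunctor T n) X).symm

end Finitary

/-! ### Corepresentability by a compact object. -/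

section Corepresentability

open Pretriangulated

variable {T : Type u} [Category.{v} T] [HasZeroObject T] [Preadditive T] [HasShift T ℤ]
  [∀ n : ℤ, (shiftFunctor T n).Additive] [Pretriangulated T]

lemma exists_of_preservesProducts {M : T ⥤ AddCommGrpCat.{v}} (hM : PreservesProducts M)
    {J : Type v} (Y : J → T) [HasProduct Y] (m : ∀ j, M.obj (Y j)) :
    ∃ m' : M.obj (∏ᶜ Y), ∀ j, M.map (Pi.π Y j) m' = m j := by
  have := hM J
  let c := isLimitFanMkObjOfIsLimit M _ _ (productIsProduct Y)
  let a : AddCommGrpCat.of (∀ j, M.obj (Y j)) ⟶ M.obj (∏ᶜ Y) :=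
    Fan.IsLimit.lift c fun j ↦ AddCommGrpCat.ofHom (Pi.evalAddMonoidHom _ j)
  have ha (j : J) : a ≫ M.map (Pi.π Y j) = AddCommGrpCat.ofHom (Pi.evalAddMonoidHom _ j) :=
    Fan.IsLimit.fac c _ j
  refine ⟨a m, fun j ↦ ?_⟩
  rw [← ConcreteCategory.comp_apply, ha]
  rfl

lemma eq_zero_of_preservesProducts {M : T ⥤ AddCommGrpCat.{v}} (hM : PreservesProducts M)
    {J : Type v} (Y : J → T) [HasProduct Y] (m : M.obj (∏ᶜ Y))
    (hm : ∀ j, M.map (Pi.π Y j) m = 0) : m = 0 := by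
  have := hM J
  let c := isLimitFanMkObjOfIsLimit M _ _ (productIsProduct Y)
  -- Elements are tested as morphisms from the free group on one generator.
  let a : AddCommGrpCat.of (ULift.{v} ℤ) ⟶ M.obj (∏ᶜ Y) :=
    AddCommGrpCat.ofHom ((zmultiplesHom _ m).comp AddEquiv.ulift.toAddMonoidHom)
  have ha : a = 0 := Fan.IsLimit.hom_ext c _ _ fun j ↦ by
    ext n
    change M.map (Pi.π Y j) (n.down • m) = M.map (Pi.π Y j) 0
    rw [map_zsmul, hm, smul_zero, map_zero]
  have h : a ⟨1⟩ = m := one_zsmul m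
  rw [← h, ha]
  rfl

/-- A homological functor on a compactly generated triangulated category that preserves coproducts
and products is corepresented by a compact object. -/
theorem exists_corepresenting (hT : IsCompactlyGenerated T) (M : T ⥤ AddCommGrpCat.{v})
    [M.IsHomological] (hM : PreservesCoproducts M) (hM' : PreservesProducts M) :
    ∃ (Z : T) (_ : IsCompactObj Z) (z : M.obj Z), ∀ Y : T,
      Function.Bijective fun f : Z ⟶ Y ↦ M.map f z := by
  obtain ⟨ι, S, h₁, h₂, h₃⟩ := hT.exists_family
  have := hT.1
  have := hT.hasProducts
  obtain ⟨Q, hQ, hQS, κ, k, hk, hkQ⟩ := exists_isFiniteClass S h₁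
  have hfin (X : T) : IsFinitary M Q X :=
    (induction_of_family h₁ h₂ h₃ (isLocalizing_isFinitary hQ hM)
      (fun i n ↦ isFinitary_of_mem (hQ.shift (hQS i) n)) X 0).of_iso
      ((shiftFunctorZero T ℤ).app X)
  -- A single element whose components are all elements of `M` on the small family; the object `x`
  -- it comes from is therefore weakly universal.
  obtain ⟨m, hm⟩ := exists_of_preservesProducts hM' (fun j : Σ a : κ, M.obj (k a) ↦ k j.1)
    fun j ↦ j.2
  obtain ⟨x, hx, f, m₀, hf⟩ := (hfin _).comesFrom m
  have weak (Y : T) (y : M.obj Y) : ∃ g : x ⟶ Y, M.map g m₀ = y := by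
    obtain ⟨t, ht, g, y', rfl⟩ := (hfin Y).comesFrom y
    obtain ⟨a, ⟨e⟩⟩ := hkQ t ht
    refine ⟨f ≫ Pi.π (fun j : Σ a : κ, M.obj (k a) ↦ k j.1) ⟨a, M.map e.inv y'⟩ ≫ e.hom ≫ g, ?_⟩
    simp only [M.map_comp, ConcreteCategory.comp_apply, hf, hm]
    simp [← ConcreteCategory.comp_apply, ← M.map_comp]
  -- The same device for relations: `l` collects all morphisms from `x` to the small family that
  -- kill `m₀`, and its factorization through `h` presents `M` as the cokernel of `Hom(x', -) ⟶
  -- Hom(x, -)`.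
  let l : x ⟶ ∏ᶜ fun j : Σ a : κ, { g : x ⟶ k a // M.map g m₀ = 0 } ↦ k j.1 :=
    Pi.lift fun j ↦ j.2.1
  obtain ⟨x', hx', h, l', hl, hh⟩ := (hfin _).factors hx l m₀
    (eq_zero_of_preservesProducts hM' _ _ fun j ↦ by
      rw [← ConcreteCategory.comp_apply, ← M.map_comp, Pi.lift_π]
      exact j.2.2)
  have ker (Y : T) (g : x ⟶ Y) (hg : M.map g m₀ = 0) : ∃ g' : x' ⟶ Y, g = h ≫ g' := by
    obtain ⟨t, ht, b, c, rfl, hb⟩ := (hfin Y).factors hx g m₀ hg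
    obtain ⟨a, ⟨e⟩⟩ := hkQ t ht
    have h₀ : l ≫ Pi.π _ ⟨a, b ≫ e.inv, by simp [hb]⟩ = b ≫ e.inv := Pi.lift_π _ _
    rw [← hl, Category.assoc] at h₀
    refine ⟨l' ≫ Pi.π _ ⟨a, b ≫ e.inv, by simp [hb]⟩ ≫ e.hom ≫ c, ?_⟩
    rw [reassoc_of% h₀, e.inv_hom_id_assoc]
  obtain ⟨z, i, d, hz⟩ := distinguished_cocone_triangle₁ h
  obtain ⟨m₁, hm₁⟩ : ∃ m₁ : M.obj z, M.map i m₁ = m₀ := exists_map_eq_of_distTriang M _ hz m₀ hh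
  obtain ⟨a, ha⟩ := weak z m₁
  have hih : i ≫ h = 0 := comp_distTriang_mor_zero₁₂ _ hz
  -- Anything that kills `m₁` is killed by `i ≫ a`. Since `i ≫ a` fixes `m₁`, it is idempotent, and
  -- its splitting corepresents `M`.
  have hkill {Y : T} (g : z ⟶ Y) (hg : M.map g m₁ = 0) : (i ≫ a) ≫ g = 0 := by
    obtain ⟨g', hg'⟩ := ker Y (a ≫ g) (by rw [M.map_comp, ConcreteCategory.comp_apply, ha, hg])
    rw [Category.assoc, hg', reassoc_of% hih, zero_comp]
  have he₁ : M.map (i ≫ a) m₁ = m₁ := by rw [M.map_comp, ConcreteCategory.comp_apply, hm₁, ha]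
  have he : (i ≫ a) ≫ (i ≫ a) = i ≫ a := by
    have := hkill (𝟙 z - i ≫ a) (by
      rw [M.map_sub]
      change M.map (𝟙 z) m₁ - M.map (i ≫ a) m₁ = 0
      rw [he₁, M.map_id]
      exact sub_self _)
    rwa [Preadditive.comp_sub, Category.comp_id, sub_eq_zero, eq_comm] at this
  obtain ⟨Z, s, p, hsp, hps⟩ := hT.exists_splitting (i ≫ a) he
  refine ⟨Z, (hQ.isCompactObj (hQ.fiber _ hz hx hx')).of_retract s p hsp, M.map p m₁,
    fun Y ↦ ⟨fun g g' hgg' ↦ ?_, fun y ↦ ?_⟩⟩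
  · dsimp only at hgg'
    have := hkill (p ≫ (g - g')) (by
      rw [M.map_comp, ConcreteCategory.comp_apply, M.map_sub]
      change M.map g (M.map p m₁) - M.map g' (M.map p m₁) = 0
      rw [hgg', sub_self])
    rw [← hps, Category.assoc, reassoc_of% hsp] at this
    rw [← sub_eq_zero, ← Category.id_comp (g - g'), ← hsp, Category.assoc, this, comp_zero]
  · obtain ⟨g, rfl⟩ := weak Y y
    refine ⟨s ≫ i ≫ g, ?_⟩
    dsimp only
    rw [← ConcreteCategory.comp_apply, ← M.map_comp, reassoc_of% hps, ← Category.assoc, M.map_comp,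
      ConcreteCategory.comp_apply, he₁, M.map_comp, ConcreteCategory.comp_apply, hm₁]

end Corepresentability

/-! ### Comparing coproduct-preserving triangulated functors. -/

section Iso

open Pretriangulated

variable {T : Type u₁} [Category.{v} T] [HasZeroObject T] [Preadditive T] [HasShift T ℤ]
  [∀ n : ℤ, (shiftFunctor T n).Additive] [Pretriangulated T]
  {T' : Type u₂} [Category.{v} T'] [HasZeroObject T'] [Preadditive T'] [HasShift T' ℤ]
  [∀ n : ℤ, (shiftFunctor T' n).Additive] [Pretriangulated T']

lemma PreservesCoproducts.comp {A : Type u} [Category.{v} A] {B : Type u₁} [Category.{v} B]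
    {E : Type u₂} [Category.{v} E] {F : A ⥤ B} {G : B ⥤ E} (hF : PreservesCoproducts F)
    (hG : PreservesCoproducts G) : PreservesCoproducts (F ⋙ G) := fun J ↦ by
  have := hF J
  have := hG J
  infer_instance

lemma PreservesCoproducts.of_iso {A : Type u₁} [Category.{v} A] {B : Type u₂} [Category.{v} B]
    {F G : A ⥤ B} (hF : PreservesCoproducts F) (e : F ≅ G) : PreservesCoproducts G := fun J ↦ by
  have := hF J
  exact preservesColimitsOfShape_of_natIso e

lemma PreservesProducts.comp {A : Type u} [Category.{v} A] {B : Type u₁} [Category.{v} B]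
    {E : Type u₂} [Category.{v} E] {F : A ⥤ B} {G : B ⥤ E} (hF : PreservesProducts F)
    (hG : PreservesProducts G) : PreservesProducts (F ⋙ G) := fun J ↦ by
  have := hF J
  have := hG J
  infer_instance

lemma PreservesProducts.of_iso {A : Type u₁} [Category.{v} A] {B : Type u₂} [Category.{v} B]
    {F G : A ⥤ B} (hF : PreservesProducts F) (e : F ≅ G) : PreservesProducts G := fun J ↦ by
  have := hF J
  exact preservesLimitsOfShape_of_natIso e

/-- A natural transformation between coproduct-preserving triangulated functors is an isomorphism
if it is one on compact objects. -/
lemma IsCompactlyGenerated.isIso_app (hT : IsCompactlyGenerated T) (hT' : IsCompactlyGenerated T')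
    {A B : T ⥤ T'} [A.CommShift ℤ] [B.CommShift ℤ] [A.IsTriangulated] [B.IsTriangulated]
    (hA : PreservesCoproducts A) (hB : PreservesCoproducts B) (τ : A ⟶ B)
    (h : ∀ t, IsCompactObj t → IsIso (τ.app t)) (X : T) : IsIso (τ.app X) :=
  hT'.isIso_of_bijective _ fun c hc ↦
    hT.bijective_app (hA.comp hc) (hB.comp hc)
      (Functor.whiskerRight τ (preadditiveCoyoneda.obj (op c))) (fun t ht ↦ by
        have := h t ht
        rw [← ConcreteCategory.isIso_iff_bijective, Functor.whiskerRight_app]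
        infer_instance) X

end Iso

/-! ### Commutation of right adjoints. -/

section Mates

variable {N : Type u₁} [Category.{v} N] {M : Type u₂} [Category.{v} M]

/-- If `Λ` intertwines adjunctions `E ⊣ T` and `E' ⊣ T'`, then its right adjoint commutes with the
right adjoints `T` and `T'`. -/
lemma isIso_homEquiv_of_adjunctions {Λ : N ⥤ M} {R : M ⥤ N} (adj : Λ ⊣ R) {E T : N ⥤ N}
    {E' T' : M ⥤ M} (a : E ⊣ T) (a' : E' ⊣ T') (σ : T ⋙ Λ ⟶ Λ ⋙ T') (σ' : E ⋙ Λ ≅ Λ ⋙ E')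
    (h : ∀ n, Λ.map (a.unit.app n) ≫ σ.app (E.obj n) ≫ T'.map (σ'.hom.app n) =
      a'.unit.app (Λ.obj n)) (m : M) :
    IsIso (adj.homEquiv (T.obj (R.obj m)) (T'.obj m)
      (σ.app (R.obj m) ≫ T'.map (adj.counit.app m))) := by
  refine isIso_of_yoneda_map_bijective _ fun n ↦ ?_
  -- The chain `Hom(n, TRm) ≅ Hom(ΛEn, m) ≅ Hom(E'Λn, m) ≅ Hom(n, RT'm)`; the rest identifies it
  -- with composition with the given map.
  let e : (n ⟶ T.obj (R.obj m)) ≃ (n ⟶ R.obj (T'.obj m)) :=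
    (a.homEquiv _ _).symm.trans ((adj.homEquiv _ _).symm.trans
      ((σ'.app n).homFromEquiv.trans ((a'.homEquiv _ _).trans (adj.homEquiv _ _))))
  convert e.bijective using 1
  ext f
  have h₁ := σ.naturality f
  have h₂ (n) : Λ.map (a.unit.app n) ≫ σ.app (E.obj n) =
      a'.unit.app (Λ.obj n) ≫ T'.map (σ'.inv.app n) := by
    rw [← h, Category.assoc, Category.assoc, ← T'.map_comp]
    simp
  have h₃ := σ.naturality (a.homEquiv _ _ |>.symm f)
  rw [← adj.homEquiv_naturality_left]
  simp only [e, Equiv.trans_apply, Iso.homFromEquiv_apply]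
  congr 1
  rw [a'.homEquiv_unit, Functor.map_comp, Iso.app_inv, ← reassoc_of% h₂ n, adj.homEquiv_counit, T'.map_comp]
  dsimp at h₃ ⊢
  rw [← reassoc_of% h₃, ← Λ.map_comp_assoc, ← a.homEquiv_unit, Equiv.apply_symm_apply]

end Mates

/-! ### Rigid objects and dual pairs. -/

section Rigid

variable {C : Type u} [Category.{v} C] [MonoidalCategory C] [MonoidalClosed C]

lemma whiskerLeft_rigidMap_ev (x y : C) :
    x ◁ rigidMap x y ≫ (ihom.ev x).app y =
      (α_ x ((ihom x).obj (𝟙_ C)) y).inv ≫ (ihom.ev x).app (𝟙_ C) ▷ y ≫ (λ_ y).hom := by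
  rw [rigidMap, MonoidalClosed.whiskerLeft_curry_ihom_ev_app]

/-- One triangle identity implies the other after pairing with `e`. When `e` is the evaluation of an
internal hom, nothing is lost, because uncurrying is injective. -/
lemma whiskerLeft_zigzag_comp {C : Type u} [Category.{v} C] [MonoidalCategory C] {x d : C}
    (e : x ⊗ d ⟶ 𝟙_ C) (η : 𝟙_ C ⟶ d ⊗ x)
    (h : x ◁ η ≫ (α_ _ _ _).inv ≫ e ▷ x = (ρ_ x).hom ≫ (λ_ x).inv) :
    x ◁ (η ▷ d ≫ (α_ _ _ _).hom ≫ d ◁ e ≫ (ρ_ d).hom) ≫ e = x ◁ (λ_ d).hom ≫ e :=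
  calc
    _ = 𝟙 _ ⊗≫ x ◁ η ▷ d ⊗≫ ((x ⊗ d) ◁ e ≫ e ▷ 𝟙_ C) ⊗≫ 𝟙 _ := by monoidal
    _ = 𝟙 _ ⊗≫ (x ◁ η ≫ (α_ x d x).inv ≫ e ▷ x) ▷ d ⊗≫ e ⊗≫ 𝟙 _ := by
      rw [whisker_exchange]
      monoidal
    _ = _ := by
      rw [h]
      monoidal

/-- A rigid object is dual to `[x, 𝟙]`. -/
abbrev IsRigidObj.exactPairing {x : C} (hx : IsRigidObj x) :
    ExactPairing ((ihom x).obj (𝟙_ C)) x :=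
  have := hx x
  let η : 𝟙_ C ⟶ (ihom x).obj (𝟙_ C) ⊗ x := MonoidalClosed.curry (ρ_ x).hom ≫ inv (rigidMap x x)
  have h₁ : x ◁ η ≫ (α_ _ _ _).inv ≫ (ihom.ev x).app (𝟙_ C) ▷ x = (ρ_ x).hom ≫ (λ_ x).inv := by
    rw [← cancel_mono (λ_ x).hom, Category.assoc, Category.assoc, ← whiskerLeft_rigidMap_ev,
      ← MonoidalCategory.whiskerLeft_comp_assoc]
    simp [η, MonoidalClosed.whiskerLeft_curry_ihom_ev_app]
  { coevaluation' := η
    evaluation' := (ihom.ev x).app (𝟙_ C)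
    coevaluation_evaluation' := h₁
    evaluation_coevaluation' := by
      rw [← cancel_mono (ρ_ _).hom]
      apply MonoidalClosed.uncurry_injective
      simp only [MonoidalClosed.uncurry_eq]
      simpa using whiskerLeft_zigzag_comp _ _ h₁ }

/-- Both `y ⊗ -` and `[x, -]` are right adjoint to `x ⊗ -`. Uniqueness identifies them, and at the
unit it identifies `y` with `[x, 𝟙]`; under these identifications the rigidity map is the
comparison. -/
lemma isRigidObj_of_exactPairing (x y : C) [ExactPairing y x] : IsRigidObj x := by
  let a := tensorLeftAdjunction y x
  have ha (z : C) : a.counit.app z = (α_ _ _ _).inv ≫ ε_ _ _ ▷ z ≫ (λ_ z).hom := by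
    simp [a, tensorLeftAdjunction, tensorLeftHomEquiv]
  have hφ (z : C) : IsIso (MonoidalClosed.curry (a.counit.app z)) := by
    have : MonoidalClosed.curry (a.counit.app z) =
        (a.rightAdjointUniq (ihom.adjunction x)).hom.app z := by
      apply MonoidalClosed.uncurry_injective
      rw [MonoidalClosed.uncurry_curry, MonoidalClosed.uncurry_eq]
      exact (Adjunction.rightAdjointUniq_hom_app_counit a (ihom.adjunction x) z).symm
    rw [this]
    infer_instance
  have hψ : MonoidalClosed.curry (ε_ y x) = (ρ_ y).inv ≫ MonoidalClosed.curry (a.counit.app (𝟙_ C)) := by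
    rw [← MonoidalClosed.curry_natural_left, ha]
    congr 1
    monoidal
  have : IsIso (MonoidalClosed.curry (ε_ y x)) := by
    rw [hψ]
    infer_instance
  intro z
  have h : MonoidalClosed.curry (ε_ y x) ▷ z ≫ rigidMap x z =
      MonoidalClosed.curry (a.counit.app z) := by
    rw [rigidMap, ← MonoidalClosed.curry_natural_left, ha]
    congr 1
    rw [associator_inv_naturality_middle_assoc, ← comp_whiskerRight_assoc,
      MonoidalClosed.whiskerLeft_curry_ihom_ev_app]
  have : rigidMap x z = inv (MonoidalClosed.curry (ε_ y x) ▷ z) ≫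
      MonoidalClosed.curry (a.counit.app z) := by rw [← h, IsIso.inv_hom_id_assoc]
  rw [this]
  infer_instance

variable {D : Type u₁} [Category.{v} D] [MonoidalCategory D]

/-- Strong monoidal functors preserve dual pairs. -/
abbrev mapExactPairing (F : D ⥤ C) [F.Monoidal] (x y : D) [ExactPairing x y] :
    ExactPairing (F.obj x) (F.obj y) where
  coevaluation' := Functor.LaxMonoidal.ε F ≫ F.map (η_ x y) ≫ Functor.OplaxMonoidal.δ F x y
  evaluation' := Functor.LaxMonoidal.μ F y x ≫ F.map (ε_ x y) ≫ Functor.OplaxMonoidal.η F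
  coevaluation_evaluation' := by
    have h := congrArg F.map (ExactPairing.coevaluation_evaluation (X := x) (Y := y))
    simp only [Functor.map_comp, Functor.Monoidal.map_whiskerLeft,
      Functor.Monoidal.map_associator_inv, Functor.Monoidal.map_whiskerRight,
      Functor.Monoidal.map_rightUnitor, Functor.Monoidal.map_leftUnitor_inv, Category.assoc,
      Functor.Monoidal.μ_δ_assoc, cancel_epi] at h
    rw [← cancel_epi (F.obj y ◁ Functor.OplaxMonoidal.η F),
      ← cancel_mono (Functor.LaxMonoidal.ε F ▷ F.obj y), ← cancel_mono (Functor.LaxMonoidal.μ F _ _)]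
    simp only [Category.assoc, comp_whiskerRight, MonoidalCategory.whiskerLeft_comp,
      Functor.Monoidal.whiskerLeft_η_ε_assoc, Functor.Monoidal.whiskerRight_η_ε_assoc]
    exact h
  evaluation_coevaluation' := by
    have h := congrArg F.map (ExactPairing.evaluation_coevaluation (X := x) (Y := y))
    simp only [Functor.map_comp, Functor.Monoidal.map_whiskerLeft,
      Functor.Monoidal.map_associator, Functor.Monoidal.map_whiskerRight,
      Functor.Monoidal.map_leftUnitor, Functor.Monoidal.map_rightUnitor_inv, Category.assoc,
      Functor.Monoidal.μ_δ_assoc, cancel_epi] at h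
    rw [← cancel_epi (Functor.OplaxMonoidal.η F ▷ F.obj x),
      ← cancel_mono (F.obj x ◁ Functor.LaxMonoidal.ε F), ← cancel_mono (Functor.LaxMonoidal.μ F _ _)]
    simp only [Category.assoc, comp_whiskerRight, MonoidalCategory.whiskerLeft_comp,
      Functor.Monoidal.whiskerLeft_η_ε_assoc, Functor.Monoidal.whiskerRight_η_ε_assoc]
    exact h

end Rigid

/-! ### The projection and Grothendieck maps on rigid objects. -/

section TensorLeftAdjunction

variable {C : Type u} [Category.{v} C] [MonoidalCategory C]

lemma tensorLeftAdjunction_unit_app (x y z : C) [ExactPairing x y] :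
    (tensorLeftAdjunction x y).unit.app z = (λ_ z).inv ≫ η_ x y ▷ z ≫ (α_ _ _ _).hom := by
  simp [tensorLeftAdjunction, tensorLeftHomEquiv]

end TensorLeftAdjunction

section Projection

variable {C : Type u₁} [Category.{v} C] [MonoidalCategory C] [SymmetricCategory C]
  [MonoidalClosed C]
  {D : Type u₂} [Category.{v} D] [MonoidalCategory D] [SymmetricCategory D] [MonoidalClosed D]
  {F : D ⥤ C} {G : C ⥤ D} {H : D ⥤ C}

/-- The dual pair `(x, [x, 𝟙])` of a rigid object of a symmetric monoidal category. -/
abbrev IsRigidObj.exactPairing' {x : C} (hx : IsRigidObj x) :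
    ExactPairing x ((ihom x).obj (𝟙_ C)) :=
  letI := hx.exactPairing
  BraidedCategory.exactPairing_swap _ _

lemma IsRigidObj.dual {x : C} (hx : IsRigidObj x) : IsRigidObj ((ihom x).obj (𝟙_ C)) :=
  letI := hx.exactPairing'
  isRigidObj_of_exactPairing _ x

lemma IsRigidObj.map [F.Monoidal] {x : D} (hx : IsRigidObj x) : IsRigidObj (F.obj x) :=
  letI := hx.exactPairing
  letI := mapExactPairing F ((ihom x).obj (𝟙_ D)) x
  isRigidObj_of_exactPairing _ (F.obj ((ihom x).obj (𝟙_ D)))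

lemma isRigidObj_unit : IsRigidObj (𝟙_ C) := isRigidObj_of_exactPairing _ (𝟙_ C)

lemma map_unit_comp_δ (F : D ⥤ C) [F.Monoidal] (x y n : D) [ExactPairing x y] :
    letI := mapExactPairing F x y
    F.map ((tensorLeftAdjunction x y).unit.app n) ≫ Functor.OplaxMonoidal.δ F x (y ⊗ n) ≫
      F.obj x ◁ Functor.OplaxMonoidal.δ F y n =
      (tensorLeftAdjunction (F.obj x) (F.obj y)).unit.app (F.obj n) := by
  let := mapExactPairing F x y
  have : η_ (F.obj x) (F.obj y) = Functor.LaxMonoidal.ε F ≫ F.map (η_ x y) ≫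
    Functor.OplaxMonoidal.δ F x y := rfl
  rw [tensorLeftAdjunction_unit_app, tensorLeftAdjunction_unit_app, this]
  simp

/-- The mate argument for `f^* ⊣ f_*`: tensoring with the dual of `x` is left adjoint to tensoring
with `x`, and `f^*` respects both. -/
lemma isIso_projMap_of_isRigidObj [F.Braided] (adj₁ : F ⊣ G) {x : D} (hx : IsRigidObj x) (y : C) :
    IsIso (projMap adj₁ x y) := by
  let := hx.exactPairing'
  let := mapExactPairing F x ((ihom x).obj (𝟙_ D))
  exact isIso_homEquiv_of_adjunctions adj₁ (tensorLeftAdjunction x ((ihom x).obj (𝟙_ D)))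
    (tensorLeftAdjunction (F.obj x) (F.obj ((ihom x).obj (𝟙_ D))))
    (Functor.Monoidal.commTensorLeft F x).inv (Functor.Monoidal.commTensorLeft F _).symm
    (fun n ↦ map_unit_comp_δ F _ _ n) y

lemma homEquiv_symm_projMap [F.Braided] (adj₁ : F ⊣ G) (x : D) (y : C) :
    F.map (projMap adj₁ x y) ≫ adj₁.counit.app _ =
      Functor.OplaxMonoidal.δ F x (G.obj y) ≫ F.obj x ◁ adj₁.counit.app y :=
  (adj₁.homEquiv_counit ..).symm.trans (Equiv.symm_apply_apply _ _)

lemma projMap_naturality_left [F.Braided] (adj₁ : F ⊣ G) {x x' : D} (f : x ⟶ x') (y : C) :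
    f ▷ G.obj y ≫ projMap adj₁ x' y = projMap adj₁ x y ≫ G.map (F.map f ▷ y) := by
  rw [projMap, projMap, ← adj₁.homEquiv_naturality_left, ← adj₁.homEquiv_naturality_right]
  simp [whisker_exchange]

lemma projMap_naturality_right [F.Braided] (adj₁ : F ⊣ G) (x : D) {y y' : C} (f : y ⟶ y') :
    x ◁ G.map f ≫ projMap adj₁ x y' = projMap adj₁ x y ≫ G.map (F.obj x ◁ f) := by
  rw [projMap, projMap, ← adj₁.homEquiv_naturality_left, ← adj₁.homEquiv_naturality_right]
  rw [← Functor.OplaxMonoidal.δ_natural_right_assoc, Category.assoc,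
    ← MonoidalCategory.whiskerLeft_comp, ← MonoidalCategory.whiskerLeft_comp,
    adj₁.counit_naturality]

/-- The projection formula, from the invertibility of the projection maps. -/
def projIso [F.Braided] (adj₁ : F ⊣ G) (h : ∀ x y, IsIso (projMap adj₁ x y)) : ProjIso F G :=
  NatIso.ofComponents
    (fun x ↦ NatIso.ofComponents (fun y ↦ @asIso _ _ _ _ _ (h x y))
      (projMap_naturality_right adj₁ x)) fun f ↦ by
    ext y
    exact projMap_naturality_left adj₁ f y

/-- The comparison map `f^* x ⊗ f^{(1)} y ⟶ f^{(1)} (x ⊗ y)`. -/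
def genGrothMap' (π : ProjIso F G) (adj₂ : G ⊣ H) (x y : D) :
    F.obj x ⊗ H.obj y ⟶ H.obj (x ⊗ y) :=
  adj₂.homEquiv _ _ ((π.inv.app x).app (H.obj y) ≫ x ◁ adj₂.counit.app y)

/-- Reduces to the variant whose form fits the mate argument, with the rigid object on the left. -/
lemma genGrothMap_eq (π : ProjIso F G) (adj₂ : G ⊣ H) (x y : D) :
    genGrothMap π adj₂ x y =
      (β_ _ _).hom ≫ genGrothMap' π adj₂ y x ≫ H.map (β_ _ _).hom := by
  rw [genGrothMap, genGrothMap', ← adj₂.homEquiv_naturality_right,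
    ← adj₂.homEquiv_naturality_left]
  simp

/-- Projection maps respect coevaluations; this is the compatibility required to apply the mate
argument to `f_* ⊣ f^{(1)}`. -/
lemma unit_comp_projMap [F.Braided] (adj₁ : F ⊣ G) (x y : D) [ExactPairing x y] (n : C) :
    letI := mapExactPairing F x y
    (tensorLeftAdjunction x y).unit.app (G.obj n) ≫ x ◁ projMap adj₁ y n ≫
      projMap adj₁ x (F.obj y ⊗ n) =
        G.map ((tensorLeftAdjunction (F.obj x) (F.obj y)).unit.app n) := by
  let := mapExactPairing F x y
  apply (adj₁.homEquiv _ _).symm.injective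
  have h₁ := map_unit_comp_δ F x y (G.obj n)
  have h₂ := (tensorLeftAdjunction (F.obj x) (F.obj y)).unit.naturality (adj₁.counit.app n)
  rw [adj₁.homEquiv_counit, adj₁.homEquiv_counit, adj₁.counit_naturality, F.map_comp, F.map_comp,
    Category.assoc, Category.assoc, homEquiv_symm_projMap,
    ← Functor.OplaxMonoidal.δ_natural_right_assoc, ← MonoidalCategory.whiskerLeft_comp,
    homEquiv_symm_projMap, MonoidalCategory.whiskerLeft_comp]
  exact ((reassoc_of% h₁) _).trans h₂.symm

lemma isIso_genGrothMap'_of_isRigidObj [F.Braided] (adj₁ : F ⊣ G) (π : ProjIso F G)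
    (hπ : ∀ x y, (π.hom.app x).app y = projMap adj₁ x y) (adj₂ : G ⊣ H) {x : D}
    (hx : IsRigidObj x) (y : D) : IsIso (genGrothMap' π adj₂ x y) := by
  let := hx.exactPairing'
  let := mapExactPairing F x ((ihom x).obj (𝟙_ D))
  refine isIso_homEquiv_of_adjunctions adj₂
    (tensorLeftAdjunction (F.obj x) (F.obj ((ihom x).obj (𝟙_ D))))
    (tensorLeftAdjunction x ((ihom x).obj (𝟙_ D)))
    (π.inv.app x) (π.symm.app ((ihom x).obj (𝟙_ D))) (fun n ↦ ?_) y
  have h := unit_comp_projMap adj₁ x ((ihom x).obj (𝟙_ D)) n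
  rw [← hπ, ← hπ] at h
  rw [← h]
  have h₁ (x y) : (π.hom.app x).app y ≫ (π.inv.app x).app y = 𝟙 _ := by simp
  dsimp at h₁ ⊢
  rw [Category.assoc, Category.assoc, reassoc_of% h₁, ← MonoidalCategory.whiskerLeft_comp, h₁]
  simp

lemma genGrothMap_naturality_left (π : ProjIso F G) (adj₂ : G ⊣ H) {x x' : D} (f : x ⟶ x')
    (y : D) : H.map f ▷ F.obj y ≫ genGrothMap π adj₂ x' y =
      genGrothMap π adj₂ x y ≫ H.map (f ▷ y) := by
  rw [genGrothMap, genGrothMap, ← adj₂.homEquiv_naturality_left, ← adj₂.homEquiv_naturality_right]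
  have h := (π.inv.app y).naturality (H.map f)
  dsimp at h
  congr 1
  rw [← G.map_comp_assoc, BraidedCategory.braiding_naturality_left, G.map_comp_assoc,
    reassoc_of% h, BraidedCategory.braiding_naturality_right_assoc]
  simp [← comp_whiskerRight]

lemma genGrothMap_naturality_right (π : ProjIso F G) (adj₂ : G ⊣ H) (x : D) {y y' : D}
    (f : y ⟶ y') : H.obj x ◁ F.map f ≫ genGrothMap π adj₂ x y' =
      genGrothMap π adj₂ x y ≫ H.map (x ◁ f) := by
  rw [genGrothMap, genGrothMap, ← adj₂.homEquiv_naturality_left, ← adj₂.homEquiv_naturality_right]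
  have h := congr_app (π.inv.naturality f) (H.obj x)
  dsimp at h
  congr 1
  rw [← G.map_comp_assoc, BraidedCategory.braiding_naturality_right, G.map_comp_assoc,
    reassoc_of% h, BraidedCategory.braiding_naturality_left_assoc, whisker_exchange]
  simp

end Projection

/-! ### Coherence identities for duals and the symmetry. -/

section Monoidal

variable {C : Type u} [Category.{v} C] [MonoidalCategory C]

lemma comp_whiskerRight_zigzag {x z z' n : C} [ExactPairing z z'] (u : 𝟙_ C ⟶ z ⊗ n)
    (s : 𝟙_ C ⟶ x ⊗ z') :
    u ≫ ((λ_ z).inv ≫ (tensorRightHomEquiv (𝟙_ C) z z' x).symm s) ▷ n =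
      s ≫ x ◁ ((ρ_ z').inv ≫ (tensorLeftHomEquiv (𝟙_ C) z z' n).symm u) := by
  simp only [tensorRightHomEquiv, tensorLeftHomEquiv, Equiv.coe_fn_symm_mk]
  calc
    _ = 𝟙 _ ⊗≫ (𝟙_ C ◁ u ≫ s ▷ (z ⊗ n)) ⊗≫ x ◁ ε_ z z' ▷ n ⊗≫ 𝟙 _ := by monoidal
    _ = _ := by
      rw [whisker_exchange]
      monoidal

variable [SymmetricCategory C]

lemma swapIso_naturality_right (a b : C) {c c' : C} (f : c ⟶ c') :
    a ◁ b ◁ f ≫ (swapIso a b c').hom = (swapIso a b c).hom ≫ b ◁ a ◁ f := by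
  simp only [swapIso, Iso.trans_hom, Iso.symm_hom, whiskerRightIso_hom, Category.assoc]
  rw [associator_inv_naturality_right_assoc, whisker_exchange_assoc, associator_naturality_right]

end Monoidal

/-! ### Projection formula, Grothendieck duality and compactness of pushforwards. -/

section Triangulated

variable {C : Type u₁} [Category.{v} C] [HasZeroObject C] [Preadditive C] [HasShift C ℤ]
    [∀ n : ℤ, (shiftFunctor C n).Additive] [Pretriangulated C] [IsTriangulated C]
    [MonoidalCategory C] [SymmetricCategory C] [MonoidalClosed C] [MonoidalPreadditive C]
    [(curriedTensor C).CommShift₂Int] [TensorTriangulated C]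
    {D : Type u₂} [Category.{v} D] [HasZeroObject D] [Preadditive D] [HasShift D ℤ]
    [∀ n : ℤ, (shiftFunctor D n).Additive] [Pretriangulated D] [IsTriangulated D]
    [MonoidalCategory D] [SymmetricCategory D] [MonoidalClosed D] [MonoidalPreadditive D]
    [(curriedTensor D).CommShift₂Int] [TensorTriangulated D]
    {F : D ⥤ C} {G : C ⥤ D} {H : D ⥤ C}

lemma preservesCoproducts_of_adj {A : Type u₁} [Category.{v} A] {B : Type u₂} [Category.{v} B]
    {L : A ⥤ B} {R : B ⥤ A} (adj : L ⊣ R) : PreservesCoproducts L := fun J ↦ by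
  have := adj.leftAdjoint_preservesColimits
  infer_instance

lemma preservesProducts_of_adj {A : Type u₁} [Category.{v} A] {B : Type u₂} [Category.{v} B]
    {L : A ⥤ B} {R : B ⥤ A} (adj : L ⊣ R) : PreservesProducts R := fun J ↦ by
  have := adj.rightAdjoint_preservesLimits
  infer_instance

instance (x : C) : (tensorLeft x).IsTriangulated := TensorTriangulated.tensorLeft_isTriangulated x

instance (x : C) : (tensorRight x).IsTriangulated :=
  TensorTriangulated.tensorRight_isTriangulated x

/-- An object `n` such that `Hom(𝟙, - ⊗ n)` is corepresented by a compact object is compact. -/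
lemma isCompactObj_of_corepresents (hD : IsRigidlyCompactlyGenerated D) {n z : D}
    (hz : IsCompactObj z) (u : 𝟙_ D ⟶ z ⊗ n)
    (hu : ∀ y, Function.Bijective fun f : z ⟶ y ↦ u ≫ f ▷ n) : IsCompactObj n := by
  have hz' := (hD.2 z).1 hz
  let := hz'.exactPairing'
  let φ := (ρ_ _).inv ≫ (tensorLeftHomEquiv (𝟙_ D) z ((ihom z).obj (𝟙_ D)) n).symm u
  have : IsIso φ := by
    refine hD.1.isIso_of_bijective _ fun t ht ↦ ?_
    let := ((hD.2 t).1 ht).exactPairing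
    let A (w : D) : (t ⟶ w) ≃ (𝟙_ D ⟶ (ihom t).obj (𝟙_ D) ⊗ w) :=
      (ρ_ t).symm.homFromEquiv.trans (tensorLeftHomEquiv (𝟙_ D) _ t w)
    have hA {w w' : D} (g : t ⟶ w) (k : w ⟶ w') : A w' (g ≫ k) = A w g ≫ _ ◁ k := by
      simp [A, tensorLeftHomEquiv]
    let B := (tensorRightHomEquiv (𝟙_ D) z ((ihom z).obj (𝟙_ D)) ((ihom t).obj (𝟙_ D))).symm.trans
      (λ_ z).homFromEquiv
    -- Writing `*` for duals: `Hom(t, z*) ≅ Hom(𝟙, t* ⊗ z*) ≅ Hom(z, t*) ≅ Hom(𝟙, t* ⊗ n) ≅ Hom(t,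
    -- n)`, the third step being corepresentability.
    let e := (A _).trans (B.trans ((Equiv.ofBijective _ (hu _)).trans (A n).symm))
    convert e.bijective using 1
    ext g
    apply (A n).injective
    simp only [e, Equiv.trans_apply, Equiv.apply_symm_apply, Equiv.ofBijective_apply]
    rw [hA]
    exact (comp_whiskerRight_zigzag u (A _ g)).symm
  have := hD.1.1
  exact ((hD.2 _).2 hz'.dual).of_iso (asIso φ)

variable [F.Braided]

lemma isCompactObj_map (hC : IsRigidlyCompactlyGenerated C) (hD : IsRigidlyCompactlyGenerated D)
    {x : D} (hx : IsCompactObj x) : IsCompactObj (F.obj x) :=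
  (hC.2 _).2 ((hD.2 _).1 hx).map

variable [F.CommShift ℤ] [F.IsTriangulated]

/-- `f^*` preserves rigid objects, which are the compact ones on both sides. -/
lemma preservesCoproducts_rightAdjoint (hC : IsRigidlyCompactlyGenerated C)
    (hD : IsRigidlyCompactlyGenerated D) (adj₁ : F ⊣ G) : PreservesCoproducts G := by
  let := adj₁.rightAdjointCommShift ℤ
  have := adj₁.commShift_of_leftAdjoint ℤ
  have := adj₁.isTriangulated_rightAdjoint
  have := hC.1.1
  exact preservesCoproducts_of_adjunction hD.1 adj₁ fun t ↦ isCompactObj_map hC hD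

/-- The projection formula. -/
theorem isIso_projMap (hC : IsRigidlyCompactlyGenerated C) (hD : IsRigidlyCompactlyGenerated D)
    (hF : PreservesCoproducts F) (adj₁ : F ⊣ G) (x : D) (y : C) : IsIso (projMap adj₁ x y) := by
  let := adj₁.rightAdjointCommShift ℤ
  have := adj₁.commShift_of_leftAdjoint ℤ
  have := adj₁.isTriangulated_rightAdjoint
  let τ : tensorRight (G.obj y) ⟶ F ⋙ tensorRight y ⋙ G :=
    { app x := projMap adj₁ x y
      naturality _ _ f := projMap_naturality_left adj₁ f y }
  -- With `y` fixed, both sides are triangulated and preserve coproducts in `x`, so rigid `x`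
  -- suffice.
  exact hD.1.isIso_app hD.1 (preservesCoproducts_of_adj (tensorRightAdj _))
    (hF.comp ((preservesCoproducts_of_adj (tensorRightAdj _)).comp
      (preservesCoproducts_rightAdjoint hC hD adj₁))) τ
    (fun t ht ↦ isIso_projMap_of_isRigidObj adj₁ ((hD.2 t).1 ht) y) x

/-- On compact `y` the map is invertible with no condition on `f^{(1)}`; preservation of coproducts
serves only to extend this to all `y`. -/
lemma isIso_genGrothMap_of_isCompactObj (hD : IsRigidlyCompactlyGenerated D)
    (adj₁ : F ⊣ G) (π : ProjIso F G) (hπ : ∀ x y, (π.hom.app x).app y = projMap adj₁ x y)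
    (adj₂ : G ⊣ H) (x : D) {y : D} (hy : IsCompactObj y) : IsIso (genGrothMap π adj₂ x y) := by
  have := isIso_genGrothMap'_of_isRigidObj adj₁ π hπ adj₂ ((hD.2 y).1 hy) x
  rw [genGrothMap_eq]
  infer_instance

/-- Generalized Grothendieck duality. -/
theorem isIso_genGrothMap (hC : IsRigidlyCompactlyGenerated C)
    (hD : IsRigidlyCompactlyGenerated D) (hF : PreservesCoproducts F) (adj₁ : F ⊣ G)
    (π : ProjIso F G) (hπ : ∀ x y, (π.hom.app x).app y = projMap adj₁ x y) (adj₂ : G ⊣ H)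
    (hH : PreservesCoproducts H) (x y : D) : IsIso (genGrothMap π adj₂ x y) := by
  let := adj₁.rightAdjointCommShift ℤ
  have := adj₁.commShift_of_leftAdjoint ℤ
  have := adj₁.isTriangulated_rightAdjoint
  let := adj₂.rightAdjointCommShift ℤ
  have := adj₂.commShift_of_leftAdjoint ℤ
  have := adj₂.isTriangulated_rightAdjoint
  let τ : F ⋙ tensorLeft (H.obj x) ⟶ tensorLeft x ⋙ H :=
    { app y := genGrothMap π adj₂ x y
      naturality _ _ f := genGrothMap_naturality_right π adj₂ x f }
  exact hD.1.isIso_app hC.1 (hF.comp (preservesCoproducts_of_adj (ihom.adjunction _)))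
    ((preservesCoproducts_of_adj (ihom.adjunction _)).comp hH) τ
    (fun t ht ↦ isIso_genGrothMap_of_isCompactObj hD adj₁ π hπ adj₂ x ht) y

/-- If `f^*` preserves products, then `f_*` preserves compact objects. -/
theorem isCompactObj_rightAdjoint_of_preservesProducts (hC : IsRigidlyCompactlyGenerated C)
    (hD : IsRigidlyCompactlyGenerated D) (adj₁ : F ⊣ G) (π : ProjIso F G)
    (hF' : PreservesProducts F) {c : C} (hc : IsCompactObj c) : IsCompactObj (G.obj c) := by
  let := ((hC.2 c).1 hc).exactPairing'
  -- On the left every factor preserves products: `f^*` by hypothesis, `c ⊗ -` as right adjoint to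
  -- tensoring with the dual of `c`, and `f_*` as a right adjoint.
  let e : F ⋙ tensorLeft c ⋙ G ≅ tensorRight (G.obj c) :=
    NatIso.ofComponents
      (fun y ↦ G.mapIso (β_ _ _) ≪≫ ((π.app y).app c).symm) (fun {y y'} f ↦ by
        have h := congr_app (π.inv.naturality f) c
        dsimp at h ⊢
        rw [Category.assoc, ← h, ← G.map_comp_assoc, ← G.map_comp_assoc,
          BraidedCategory.braiding_naturality_right])
  have h : PreservesProducts (tensorRight (G.obj c)) :=
    (hF'.comp ((preservesProducts_of_adj (tensorLeftAdjunction c ((ihom c).obj (𝟙_ C)))).comp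
      (preservesProducts_of_adj adj₁))).of_iso e
  obtain ⟨z, hz, u, hu⟩ := exists_corepresenting hD.1
    (tensorRight (G.obj c) ⋙ preadditiveCoyoneda.obj (op (𝟙_ D)))
    ((preservesCoproducts_of_adj (tensorRightAdj _)).comp ((hD.2 _).2 isRigidObj_unit))
    (h.comp fun J ↦ inferInstance)
  exact isCompactObj_of_corepresents hD hz u hu

end Triangulated

/-! ### Pairings, traces and the ur-Wirthmüller map. -/

section Pairing

variable {C : Type u} [Category.{v} C] [MonoidalCategory C] [SymmetricCategory C]

lemma swapIso_naturality_left {a a' : C} (f : a ⟶ a') (b c : C) :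
    f ▷ (b ⊗ c) ≫ (swapIso a' b c).hom = (swapIso a b c).hom ≫ b ◁ f ▷ c := by
  simp only [swapIso, Iso.trans_hom, Iso.symm_hom, whiskerRightIso_hom, Category.assoc]
  rw [associator_inv_naturality_left_assoc, ← comp_whiskerRight_assoc,
    BraidedCategory.braiding_naturality_left, comp_whiskerRight_assoc, associator_naturality_middle]

/-- The map `a ⟶ z` corresponding to `𝟙 ⟶ z ⊗ d` under a pairing of `a` and `d`. -/
def pairMap {a d : C} (p : a ⊗ d ⟶ 𝟙_ C) {z : C} (s : 𝟙_ C ⟶ z ⊗ d) : a ⟶ z :=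
  (ρ_ a).inv ≫ a ◁ s ≫ (swapIso a z d).hom ≫ z ◁ p ≫ (ρ_ z).hom

lemma pairMap_whiskerRight_comp {a a' d : C} (f : a ⟶ a') (p : a' ⊗ d ⟶ 𝟙_ C) {z : C}
    (s : 𝟙_ C ⟶ z ⊗ d) : pairMap (f ▷ d ≫ p) s = f ≫ pairMap p s := by
  simp only [pairMap]
  rw [MonoidalCategory.whiskerLeft_comp, Category.assoc, ← reassoc_of% swapIso_naturality_left,
    whisker_exchange_assoc, rightUnitor_inv_naturality_assoc]

/-- After exchanging the two members of the dual pair by the symmetry, this is the duality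
adjunction. -/
lemma bijective_pairMap (a d z : C) [ExactPairing d a] :
    Function.Bijective fun s : 𝟙_ C ⟶ z ⊗ d ↦ pairMap (ε_ d a) s := by
  let := BraidedCategory.exactPairing_swap d a
  convert ((tensorRightHomEquiv (𝟙_ C) a d z).symm.trans (λ_ a).homFromEquiv).bijective using 1
  ext s
  have h : s ▷ a = (β_ _ _).hom ≫ a ◁ s ≫ (β_ _ _).hom := by
    rw [BraidedCategory.braiding_naturality_right, SymmetricCategory.symmetry_assoc]
  have h' : ε_ a d = (β_ _ _).hom ≫ ε_ d a := rfl
  have h'' : z ◁ (β_ a d).hom ≫ z ◁ (β_ d a).hom = 𝟙 _ := by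
    rw [← MonoidalCategory.whiskerLeft_comp, SymmetricCategory.symmetry,
      MonoidalCategory.whiskerLeft_id]
  simp [pairMap, tensorRightHomEquiv, h, h', swapIso, -BraidedCategory.braiding_tensor_right_hom,
    BraidedCategory.braiding_tensor_right_hom, reassoc_of% h'']

lemma whiskerLeft_pairMap (w : C) {a d z : C} (p : a ⊗ d ⟶ 𝟙_ C) (s : 𝟙_ C ⟶ z ⊗ d) :
    w ◁ pairMap p s ≫ (β_ w z).hom = (ρ_ (w ⊗ a)).inv ≫ (w ⊗ a) ◁ s ≫
      (swapIso (w ⊗ a) z d).hom ≫ z ◁ ((α_ _ _ _).hom ≫ w ◁ p ≫ (ρ_ w).hom) := by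
  simp only [pairMap, swapIso, BraidedCategory.braiding_tensor_left_hom, Iso.trans_hom,
    Iso.symm_hom, whiskerRightIso_hom]
  calc
    _ = 𝟙 _ ⊗≫ w ◁ a ◁ s ⊗≫ w ◁ (β_ a z).hom ▷ d ⊗≫
        ((w ⊗ z) ◁ p ≫ (β_ w z).hom ▷ 𝟙_ C) ⊗≫ 𝟙 _ := by monoidal
    _ = _ := by
      rw [whisker_exchange]
      monoidal

end Pairing

section Wirthmuller

variable {C : Type u₁} [Category.{v} C] [MonoidalCategory C] [SymmetricCategory C]
  [MonoidalClosed C]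
  {D : Type u₂} [Category.{v} D] [MonoidalCategory D] [SymmetricCategory D] [MonoidalClosed D]
  {F : D ⥤ C} {G : C ⥤ D} {H : D ⥤ C} {L : C ⥤ D}

/-- The map `f_* (ω ⊗ f^* y) ⟶ y` adjoint to `ω ⊗ f^* y ⟶ f^{(1)} y`. -/
def grothTrace (π : ProjIso F G) (adj₂ : G ⊣ H) (y : D) :
    G.obj (dualizingObj H ⊗ F.obj y) ⟶ y :=
  G.map (β_ _ _).hom ≫ (π.inv.app y).app (dualizingObj H) ≫ y ◁ adj₂.counit.app (𝟙_ D) ≫ (ρ_ y).hom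

lemma grothMap_eq (π : ProjIso F G) (adj₂ : G ⊣ H) (y : D) :
    grothMap π adj₂ y = adj₂.homEquiv _ _ (grothTrace π adj₂ y) := by
  rw [grothMap, genGrothMap, ← adj₂.homEquiv_naturality_right]
  congr 1
  simp only [grothTrace, Category.assoc]
  rw [← BraidedCategory.braiding_naturality_right_assoc]
  simp

/-- Naturality of `π` moves the counit past it, where a triangle identity cancels it against the
unit; the result no longer involves `f_{(1)}`. -/
lemma urWirthMap_comp_counit (π : ProjIso F G) (adj₀ : L ⊣ F) (adj₂ : G ⊣ H) (y : D) :
    urWirthMap π adj₀ adj₂ (F.obj y) ≫ adj₀.counit.app y = grothTrace π adj₂ y := by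
  have h := congr_app (π.inv.naturality (adj₀.counit.app y)) (dualizingObj H)
  dsimp at h
  simp only [urWirthMap, grothTrace, Category.assoc]
  rw [← rightUnitor_naturality]
  dsimp only [Functor.id_obj]
  rw [whisker_exchange_assoc, ← reassoc_of% h, ← G.map_comp_assoc,
    ← G.map_comp_assoc, Category.assoc, ← comp_whiskerRight, adj₀.right_triangle_components]
  simp

variable [F.Braided]

lemma map_swapIso_δ (x y z : D) :
    F.map (swapIso x y z).hom ≫ Functor.OplaxMonoidal.δ F _ _ ≫
      F.obj y ◁ Functor.OplaxMonoidal.δ F x z =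
    Functor.OplaxMonoidal.δ F _ _ ≫ F.obj x ◁ Functor.OplaxMonoidal.δ F y z ≫
      (swapIso (F.obj x) (F.obj y) (F.obj z)).hom := by
  simp only [swapIso, Iso.trans_hom, Iso.symm_hom, whiskerRightIso_hom, F.map_comp, Category.assoc]
  rw [← Functor.OplaxMonoidal.associativity, ← Functor.OplaxMonoidal.δ_natural_left_assoc,
    ← comp_whiskerRight_assoc, F.map_braiding, reassoc_of% Functor.OplaxMonoidal.associativity_inv]
  simp

lemma projMap_swapIso (adj₁ : F ⊣ G) (x y : D) (z : C) :
    x ◁ projMap adj₁ y z ≫ projMap adj₁ x (F.obj y ⊗ z) ≫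
      G.map (swapIso (F.obj x) (F.obj y) z).hom =
    (swapIso x y (G.obj z)).hom ≫ y ◁ projMap adj₁ x z ≫ projMap adj₁ y (F.obj x ⊗ z) := by
  apply (adj₁.homEquiv _ _).symm.injective
  rw [adj₁.homEquiv_counit, adj₁.homEquiv_counit]
  simp only [F.map_comp, Category.assoc]
  rw [homEquiv_symm_projMap, adj₁.counit_naturality, reassoc_of% homEquiv_symm_projMap,
    ← Functor.OplaxMonoidal.δ_natural_right_assoc, ← Functor.OplaxMonoidal.δ_natural_right_assoc,
    ← MonoidalCategory.whiskerLeft_comp_assoc, ← MonoidalCategory.whiskerLeft_comp,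
    homEquiv_symm_projMap, homEquiv_symm_projMap, MonoidalCategory.whiskerLeft_comp_assoc,
    MonoidalCategory.whiskerLeft_comp]
  dsimp only [Functor.id_obj]
  rw [swapIso_naturality_right, reassoc_of% map_swapIso_δ]

/-- The lax monoidal product `f_* b ⊗ f_* z ⟶ f_* (b ⊗ z)`, evaluated at the element of `f_* z`
given by `r`, is the pushforward of tensoring with `r`. -/
lemma whiskerLeft_homEquiv_projMap (adj₁ : F ⊣ G) (b z : C) (r : 𝟙_ C ⟶ z) :
    (ρ_ (G.obj b)).inv ≫ G.obj b ◁ adj₁.homEquiv _ _ (Functor.OplaxMonoidal.η F ≫ r) ≫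
      projMap adj₁ (G.obj b) z ≫ G.map (adj₁.counit.app b ▷ z) =
    G.map ((ρ_ b).inv ≫ b ◁ r) := by
  apply (adj₁.homEquiv _ _).symm.injective
  rw [adj₁.homEquiv_counit, adj₁.homEquiv_counit]
  simp only [F.map_comp, Category.assoc]
  rw [adj₁.counit_naturality, reassoc_of% homEquiv_symm_projMap,
    ← Functor.OplaxMonoidal.δ_natural_right_assoc,
    ← MonoidalCategory.whiskerLeft_comp_assoc, ← adj₁.homEquiv_counit, Equiv.symm_apply_apply]
  dsimp only [Functor.id_obj]
  rw [adj₁.counit_naturality, MonoidalCategory.whiskerLeft_comp_assoc, whisker_exchange]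
  simp

/-- The pairing of `f_* (ω ⊗ c)` and `f_* c'` induced by a pairing of `c` and `c'`. -/
def pushPairing (adj₁ : F ⊣ G) (adj₂ : G ⊣ H) {c c' : C} (p : c ⊗ c' ⟶ 𝟙_ C) :
    G.obj (dualizingObj H ⊗ c) ⊗ G.obj c' ⟶ 𝟙_ D :=
  projMap adj₁ _ c' ≫ G.map (adj₁.counit.app _ ▷ c') ≫
    G.map ((α_ _ _ _).hom ≫ dualizingObj H ◁ p ≫ (ρ_ _).hom) ≫ adj₂.counit.app (𝟙_ D)

/-- Compares two ways from elements of `f^* y ⊗ c'` to morphisms `f_* (ω ⊗ c) ⟶ y`: pair upstairs,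
push forward and take the trace, or push the element forward and pair downstairs. No perfectness of
`p` is used. -/
lemma pairMap_pushPairing (adj₁ : F ⊣ G) (π : ProjIso F G)
    (hπ : ∀ x y, (π.hom.app x).app y = projMap adj₁ x y) (adj₂ : G ⊣ H) {c c' : C}
    (p : c ⊗ c' ⟶ 𝟙_ C) {y : D} (s : 𝟙_ C ⟶ F.obj y ⊗ c') :
    pairMap (pushPairing adj₁ adj₂ p)
      (adj₁.homEquiv _ _ (Functor.OplaxMonoidal.η F ≫ s) ≫ (π.inv.app y).app c') =
        G.map (dualizingObj H ◁ pairMap p s) ≫ grothTrace π adj₂ y := by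
  have h₁ (z : C) : projMap adj₁ y z ≫ (π.inv.app y).app z = 𝟙 _ := by
    rw [← hπ]
    exact congr_app (π.hom_inv_id_app y) z
  have h₁' (z : C) : (π.inv.app y).app z ≫ projMap adj₁ y z = 𝟙 _ := by
    rw [← hπ]
    exact congr_app (π.inv_hom_id_app y) z
  have h₂ := (π.inv.app y).naturality
  dsimp at h₁ h₁' h₂
  rw [grothTrace, ← G.map_comp_assoc, whiskerLeft_pairMap, pairMap, pushPairing]
  have h₃ : G.obj (dualizingObj H ⊗ c) ◁ (π.inv.app y).app c' ≫
      (swapIso _ y (G.obj c')).hom ≫ y ◁ projMap adj₁ (G.obj (dualizingObj H ⊗ c)) c' =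
      projMap adj₁ _ _ ≫ G.map (swapIso _ _ c').hom ≫ (π.inv.app y).app _ := by
    have h := projMap_swapIso adj₁ (G.obj (dualizingObj H ⊗ c)) y c'
    rw [← Category.assoc, ← Category.assoc, ← Category.comp_id (_ ≫ _ ◁ projMap adj₁ _ _), ← h₁,
      Category.assoc, Category.assoc, Category.assoc, ← reassoc_of% h,
      ← MonoidalCategory.whiskerLeft_comp_assoc, h₁']
    simp
  simp only [MonoidalCategory.whiskerLeft_comp, Category.assoc]
  have h₄ := whiskerLeft_homEquiv_projMap adj₁ (dualizingObj H ⊗ c) _ s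
  have h₅ := swapIso_naturality_left (adj₁.counit.app (dualizingObj H ⊗ c)) (F.obj y) c'
  dsimp only [Functor.id_obj, Functor.comp_obj] at h₄ h₅
  rw [reassoc_of% h₃, ← reassoc_of% h₂, ← reassoc_of% h₂, ← G.map_comp_assoc (swapIso _ _ _).hom,
    ← h₅, G.map_comp_assoc, reassoc_of% h₄]
  simp

end Wirthmuller

section Pairing

variable {C : Type u} [Category.{v} C] [MonoidalCategory C]

lemma bijective_whiskerRight_comp_evaluation (w a d : C) [ExactPairing d a] :
    Function.Bijective fun k : w ⟶ a ↦ k ▷ d ≫ ε_ d a := by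
  convert ((λ_ a).symm.homToEquiv.trans (tensorRightHomEquiv w d a (𝟙_ C)).symm).bijective using 1
  ext k
  simp only [Iso.homToEquiv, tensorRightHomEquiv, Equiv.trans_apply, Equiv.coe_fn_mk,
    Equiv.coe_fn_symm_mk]
  dsimp
  monoidal

end Pairing

section Wirthmuller

variable {C : Type u₁} [Category.{v} C] [MonoidalCategory C] [SymmetricCategory C]
  [MonoidalClosed C]
  {D : Type u₂} [Category.{v} D] [MonoidalCategory D] [SymmetricCategory D] [MonoidalClosed D]
  {F : D ⥤ C} {G : C ⥤ D} {H : D ⥤ C} {L : C ⥤ D}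

lemma grothMap_naturality (π : ProjIso F G) (adj₂ : G ⊣ H) {y y' : D} (f : y ⟶ y') :
    dualizingObj H ◁ F.map f ≫ grothMap π adj₂ y' = grothMap π adj₂ y ≫ H.map f := by
  simp only [grothMap, Category.assoc]
  rw [reassoc_of% genGrothMap_naturality_right, ← H.map_comp, ← H.map_comp, leftUnitor_naturality]

/-- The Grothendieck duality maps, as a natural transformation. -/
def grothNat (π : ProjIso F G) (adj₂ : G ⊣ H) : F ⋙ tensorLeft (dualizingObj H) ⟶ H where
  app y := grothMap π adj₂ y
  naturality _ _ f := grothMap_naturality π adj₂ f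

/-- The natural transformation `f^* ⟶ [ω, f^{(1)} -]` adjoint to Grothendieck duality. -/
def coWirthNat (π : ProjIso F G) (adj₂ : G ⊣ H) : F ⟶ H ⋙ ihom (dualizingObj H) where
  app y := MonoidalClosed.curry (grothMap π adj₂ y)
  naturality y y' f := by
    dsimp
    rw [← MonoidalClosed.curry_natural_left, grothMap_naturality,
      MonoidalClosed.curry_natural_right]

/-- The ur-Wirthmüller maps, as a natural transformation. -/
def urWirthNat (π : ProjIso F G) (adj₀ : L ⊣ F) (adj₂ : G ⊣ H) :
    tensorLeft (dualizingObj H) ⋙ G ⟶ L where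
  app x := urWirthMap π adj₀ adj₂ x
  naturality x x' f := by
    have h := congr_app (π.inv.naturality (L.map f)) (dualizingObj H)
    have h' := adj₀.unit.naturality f
    dsimp at h h' ⊢
    simp only [urWirthMap, Category.assoc]
    rw [← rightUnitor_naturality]
    dsimp only [Functor.id_obj]
    rw [whisker_exchange_assoc, ← reassoc_of% h, ← G.map_comp_assoc,
      BraidedCategory.braiding_naturality_right, G.map_comp_assoc,
      ← G.map_comp_assoc (f ▷ _), ← comp_whiskerRight, h', comp_whiskerRight, G.map_comp_assoc]

/-- Both sides are transposes of the trace, so invertibility of the ur-Wirthmüller map can be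
checked on a map that does not mention `f_{(1)}`. -/
lemma conjugateEquiv_urWirthNat (π : ProjIso F G) (adj₀ : L ⊣ F) (adj₂ : G ⊣ H) :
    conjugateEquiv adj₀ ((ihom.adjunction (dualizingObj H)).comp adj₂) (urWirthNat π adj₀ adj₂) =
      coWirthNat π adj₂ := by
  ext y
  rw [conjugateEquiv_apply_app]
  simp only [coWirthNat, grothMap_eq, ← urWirthMap_comp_counit π adj₀]
  simp [MonoidalClosed.curry_eq, adj₂.homEquiv_unit, urWirthNat]

variable [F.Braided]

/-- `Hom(w, f_* (ω ⊗ c)) ≅ Hom(f^* w ⊗ c', ω) ≅ Hom(f_* (f^* w ⊗ c'), 𝟙) ≅ Hom(w ⊗ f_* c', 𝟙)`, by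
duality, the definition of `ω` and the projection formula. -/
lemma bijective_whiskerRight_comp_pushPairing (adj₁ : F ⊣ G) (π : ProjIso F G)
    (hπ : ∀ x y, (π.hom.app x).app y = projMap adj₁ x y) (adj₂ : G ⊣ H) (c c' : C)
    [ExactPairing c' c] (w : D) :
    Function.Bijective fun k : w ⟶ G.obj (dualizingObj H ⊗ c) ↦
      k ▷ G.obj c' ≫ pushPairing adj₁ adj₂ (ε_ c' c) := by
  let e : (w ⟶ G.obj (dualizingObj H ⊗ c)) ≃ (w ⊗ G.obj c' ⟶ 𝟙_ D) :=
    (adj₁.homEquiv _ _).symm.trans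
      ((tensorRightHomEquiv (F.obj w) c' c (dualizingObj H)).symm.trans
        ((adj₂.homEquiv _ _).symm.trans ((π.app w).app c').symm.homFromEquiv))
  convert e.bijective using 1
  ext k
  simp only [e, Equiv.trans_apply, Iso.homFromEquiv_apply, tensorRightHomEquiv, Equiv.coe_fn_symm_mk,
    pushPairing, adj₁.homEquiv_counit, adj₂.homEquiv_counit]
  rw [reassoc_of% projMap_naturality_left, ← hπ]
  simp

/-- By the preceding bijection `f_* (ω ⊗ c)` represents `Hom(- ⊗ f_* c', 𝟙)`, as does the dual of
the rigid object `f_* c'`. The resulting isomorphism `ξ` carries one pairing to the other. -/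
lemma bijective_pairMap_pushPairing (adj₁ : F ⊣ G) (π : ProjIso F G)
    (hπ : ∀ x y, (π.hom.app x).app y = projMap adj₁ x y) (adj₂ : G ⊣ H) (c c' : C)
    [ExactPairing c' c] (hc' : IsRigidObj (G.obj c')) (y : D) :
    Function.Bijective fun s : 𝟙_ D ⟶ y ⊗ G.obj c' ↦
      pairMap (pushPairing adj₁ adj₂ (ε_ c' c)) s := by
  let := hc'.exactPairing'
  have h₁ (w : D) := bijective_whiskerRight_comp_evaluation w
    ((ihom (G.obj c')).obj (𝟙_ D)) (G.obj c')
  have h₂ := bijective_whiskerRight_comp_pushPairing adj₁ π hπ adj₂ c c'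
  obtain ⟨ξ, hξ⟩ := (h₁ _).2 (pushPairing adj₁ adj₂ (ε_ c' c))
  have : IsIso ξ := by
    refine isIso_of_yoneda_map_bijective _ fun w ↦ ?_
    rw [← Function.Bijective.of_comp_iff' (h₁ w)]
    convert h₂ w using 1
    ext k
    simp [← hξ]
  simp only [← hξ, pairMap_whiskerRight_comp]
  exact (asIso ξ).symm.homFromEquiv.bijective.comp (bijective_pairMap _ _ y)

lemma bijective_map_comp_grothTrace (adj₁ : F ⊣ G) (π : ProjIso F G)
    (hπ : ∀ x y, (π.hom.app x).app y = projMap adj₁ x y) (adj₂ : G ⊣ H) (c c' : C)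
    [ExactPairing c' c] (hc' : IsRigidObj (G.obj c')) (y : D) :
    Function.Bijective fun g : c ⟶ F.obj y ↦
      G.map (dualizingObj H ◁ g) ≫ grothTrace π adj₂ y := by
  rw [← Function.Bijective.of_comp_iff _ (bijective_pairMap c c' (F.obj y))]
  let e : (𝟙_ C ⟶ F.obj y ⊗ c') ≃ (𝟙_ D ⟶ y ⊗ G.obj c') :=
    (Functor.Monoidal.εIso F).homFromEquiv.trans ((adj₁.homEquiv _ _).trans
      ((π.app y).app c').symm.homToEquiv)
  convert (bijective_pairMap_pushPairing adj₁ π hπ adj₂ c c' hc' y).comp e.bijective using 1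
  ext s
  exact (pairMap_pushPairing adj₁ π hπ adj₂ (ε_ c' c) s).symm

end Wirthmuller

section Triangulated

variable {C : Type u₁} [Category.{v} C] [HasZeroObject C] [Preadditive C] [HasShift C ℤ]
    [∀ n : ℤ, (shiftFunctor C n).Additive] [Pretriangulated C] [IsTriangulated C]
    [MonoidalCategory C] [SymmetricCategory C] [MonoidalClosed C]
    {D : Type u₂} [Category.{v} D] [Preadditive D]
    [MonoidalCategory D] [SymmetricCategory D] [MonoidalClosed D]
    {F : D ⥤ C} {G : C ⥤ D} {H : D ⥤ C} [F.Braided]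

/-- On morphisms from a compact `c` the map is pushforward followed by the trace, then transposed.
It is bijective because the dual of `c` has compact, hence rigid, pushforward. -/
theorem isIso_coWirthNat (hC : IsRigidlyCompactlyGenerated C)
    (hD : IsRigidlyCompactlyGenerated D) (adj₁ : F ⊣ G) (π : ProjIso F G)
    (hπ : ∀ x y, (π.hom.app x).app y = projMap adj₁ x y) (adj₂ : G ⊣ H)
    (hG : ∀ c : C, IsCompactObj c → IsCompactObj (G.obj c)) :
    IsIso (coWirthNat π adj₂) := by
  rw [NatTrans.isIso_iff_isIso_app]
  refine fun y ↦ hC.1.isIso_of_bijective _ fun c hc ↦ ?_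
  have hc := (hC.2 c).1 hc
  let := hc.exactPairing
  let e : (c ⟶ F.obj y) ≃ (c ⟶ (H ⋙ ihom (dualizingObj H)).obj y) :=
    (Equiv.ofBijective _ (bijective_map_comp_grothTrace adj₁ π hπ adj₂ c
      ((ihom c).obj (𝟙_ C)) ((hD.2 _).1 (hG _ ((hC.2 _).2 hc.dual))) y)).trans
    ((adj₂.homEquiv _ _).trans ((ihom.adjunction (dualizingObj H)).homEquiv _ _))
  convert e.bijective using 1
  ext g
  dsimp only [coWirthNat, e, Equiv.trans_apply, Equiv.ofBijective_apply]
  rw [← MonoidalClosed.curry_natural_left, grothMap_eq, ← adj₂.homEquiv_naturality_left]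
  rfl

end Triangulated

/-! ### Conjugation with parameters, and assembly of the canonical isomorphisms. -/

section Conjugates

/-- Conjugates of a natural isomorphism of bifunctors with parametrized right adjoints. -/
def conjugateNatIso {P : Type*} [Category* P] {X : Type*} [Category* X] {Y : Type*} [Category* Y]
    {A B : P ⥤ X ⥤ Y} {R S : Pᵒᵖ ⥤ Y ⥤ X}
    (a : ∀ p, A.obj p ⊣ R.obj (op p)) (b : ∀ p, B.obj p ⊣ S.obj (op p))
    (ha : ∀ {p p' : P} (f : p ⟶ p'), conjugateEquiv (a p') (a p) (A.map f) = R.map f.op)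
    (hb : ∀ {p p' : P} (f : p ⟶ p'), conjugateEquiv (b p') (b p) (B.map f) = S.map f.op)
    (τ : B ≅ A) : R ≅ S :=
  NatIso.ofComponents (fun p ↦ conjugateIsoEquiv (a p.unop) (b p.unop) (τ.app p.unop))
    fun {p p'} f ↦ by
      change R.map f.unop.op ≫ conjugateEquiv (a _) (b _) (τ.hom.app _) =
        conjugateEquiv (a _) (b _) (τ.hom.app _) ≫ S.map f.unop.op
      rw [← ha, ← hb, conjugateEquiv_comp, conjugateEquiv_comp, τ.hom.naturality]

variable {C : Type u} [Category.{v} C] [MonoidalCategory C] [SymmetricCategory C]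
  [MonoidalClosed C]

/-- Supplies naturality in the parameter for the relations conjugated with the right-hand tensor
factor fixed. -/
lemma conjugateEquiv_tensorRightAdj {x y : C} (f : x ⟶ y) :
    conjugateEquiv (tensorRightAdj y) (tensorRightAdj x) ((curriedTensor C).flip.map f) =
      MonoidalClosed.pre f := by
  ext z
  simp only [conjugateEquiv_apply_app, MonoidalClosed.pre, tensorRightAdj,
    Adjunction.ofNatIsoLeft_unit, Adjunction.ofNatIsoLeft_counit]
  simp [← Functor.map_comp]

end Conjugates

section Assembly

open Functor MonoidalClosed

variable {C : Type u₁} [Category.{v} C] [MonoidalCategory C] [SymmetricCategory C]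
  [MonoidalClosed C]
  {D : Type u₂} [Category.{v} D] [MonoidalCategory D] [SymmetricCategory D] [MonoidalClosed D]
  {F : D ⥤ C} {G : C ⥤ D} {H : D ⥤ C} {L K : C ⥤ D}

/-- Generalized Grothendieck duality as a natural isomorphism. -/
def genGrothIso (π : ProjIso F G) (adj₂ : G ⊣ H) (h : ∀ x y, IsIso (genGrothMap π adj₂ x y)) :
    H ⋙ curriedTensor C ⋙ (whiskeringLeft D C C).obj F ≅
      curriedTensor D ⋙ (whiskeringRight D D C).obj H :=
  NatIso.ofComponents
    (fun x ↦ NatIso.ofComponents (fun y ↦ @asIso _ _ _ _ _ (h x y))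
      (fun f ↦ genGrothMap_naturality_right π adj₂ x f)) fun f ↦ by
    ext y
    exact genGrothMap_naturality_left π adj₂ f y

/-- The left projection formula, transported from the right one. -/
def leftProjIso (π : ProjIso F G) (W : tensorLeft (dualizingObj H) ⋙ G ≅ L) :
    curriedTensor D ⋙ (whiskeringLeft C D D).obj L ≅
      F ⋙ curriedTensor C ⋙ (whiskeringRight C C D).obj L :=
  NatIso.ofComponents
    (fun x ↦ NatIso.ofComponents
      (fun y ↦ whiskerLeftIso x (W.symm.app y) ≪≫ (π.app x).app _ ≪≫
        G.mapIso (swapIso (F.obj x) (dualizingObj H) y) ≪≫ W.app (F.obj x ⊗ y)) (fun {y y'} f ↦ by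
        have h₁ := W.inv.naturality f
        have h₂ := (π.hom.app x).naturality (dualizingObj H ◁ f)
        have h₃ := W.hom.naturality (F.obj x ◁ f)
        dsimp at h₁ h₂ h₃ ⊢
        simp only [Category.assoc, whiskerLeftIso_hom, Iso.app_hom, Iso.symm_hom]
        rw [← h₃, ← G.map_comp_assoc, ← swapIso_naturality_right, G.map_comp_assoc,
          ← reassoc_of% h₂, ← MonoidalCategory.whiskerLeft_comp_assoc,
          ← MonoidalCategory.whiskerLeft_comp_assoc, h₁]))
    fun {x x'} f ↦ by
      ext y
      have h₂ := congr_app (π.hom.naturality f) (dualizingObj H ⊗ y)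
      have h₃ := W.hom.naturality (F.map f ▷ y)
      dsimp at h₂ h₃ ⊢
      simp only [Category.assoc, whiskerLeftIso_hom, Iso.app_hom, Iso.symm_hom]
      rw [← h₃, ← G.map_comp_assoc, ← swapIso_naturality_left, G.map_comp_assoc,
        ← reassoc_of% h₂, whisker_exchange_assoc]

/-- The isomorphism `f_{(1)} (f^* x ⊗ y) ≅ f_* (f^{(1)} x ⊗ y)`. -/
def mixedIso (gr : F ⋙ tensorLeft (dualizingObj H) ≅ H)
    (W : tensorLeft (dualizingObj H) ⋙ G ≅ L) :
    F ⋙ curriedTensor C ⋙ (whiskeringRight C C D).obj L ≅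
      H ⋙ curriedTensor C ⋙ (whiskeringRight C C D).obj G :=
  NatIso.ofComponents
    (fun x ↦ NatIso.ofComponents
      (fun y ↦ W.symm.app (F.obj x ⊗ y) ≪≫ G.mapIso (α_ (dualizingObj H) (F.obj x) y).symm ≪≫
        G.mapIso (whiskerRightIso (gr.app x) y)) (fun {y y'} f ↦ by
        have h := W.inv.naturality (F.obj x ◁ f)
        dsimp at h ⊢
        simp only [Category.assoc, reassoc_of% h, ← G.map_comp, whiskerRightIso_hom, Iso.app_hom]
        rw [associator_inv_naturality_right_assoc, whisker_exchange]))
    fun {x x'} f ↦ by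
      ext y
      have h := W.inv.naturality (F.map f ▷ y)
      have h' := gr.hom.naturality f
      dsimp at h h' ⊢
      simp only [Category.assoc, reassoc_of% h, ← G.map_comp, whiskerRightIso_hom, Iso.app_hom]
      rw [associator_inv_naturality_middle_assoc, ← comp_whiskerRight, h', comp_whiskerRight]

variable [F.Braided]

/-- The canonical isomorphisms, from generalized Grothendieck duality and the ur-Wirthmüller
isomorphism. -/
def dualityIsos (π : ProjIso F G) (adj₀ : L ⊣ F) (adj₁ : F ⊣ G) (adj₂ : G ⊣ H) (adj₃ : H ⊣ K)
    (h : ∀ x y, IsIso (genGrothMap π adj₂ x y)) [IsIso (grothNat π adj₂)]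
    [IsIso (urWirthNat π adj₀ adj₂)] : DualityIsos π adj₀ adj₁ adj₂ adj₃ where
  groth := asIso (grothNat π adj₂)
  groth_hom _ := rfl
  coGroth := conjugateIsoEquiv adj₃ (adj₁.comp (ihom.adjunction (dualizingObj H)))
    (asIso (grothNat π adj₂))
  coGroth_hom := rfl
  genGroth := genGrothIso π adj₂ h
  genGroth_hom _ _ := rfl
  genCoGroth := conjugateNatIso
    (A := curriedTensor D ⋙ (whiskeringRight D D C).obj H)
    (B := H ⋙ curriedTensor C ⋙ (whiskeringLeft D C C).obj F) (fun x ↦ (ihom.adjunction x).comp adj₃)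
    (fun x ↦ adj₁.comp (ihom.adjunction (H.obj x)))
    (fun f ↦ conjugateEquiv_whiskerRight (ihom.adjunction _) (ihom.adjunction _) adj₃
      ((curriedTensor D).map f))
    (fun f ↦ conjugateEquiv_whiskerLeft (ihom.adjunction _) (ihom.adjunction _) adj₁
      ((curriedTensor C).map (H.map f)))
    (genGrothIso π adj₂ h)
  genCoGroth_hom _ := rfl
  pseudoInthom := conjugateNatIso
    (A := (curriedTensor D ⋙ (whiskeringRight D D C).obj H).flip)
    (B := (H ⋙ curriedTensor C ⋙ (whiskeringLeft D C C).obj F).flip)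
    (fun x ↦ (tensorRightAdj x).comp adj₃)
    (fun x ↦ adj₃.comp (tensorRightAdj (F.obj x)))
    (fun f ↦ (conjugateEquiv_whiskerRight (tensorRightAdj _) (tensorRightAdj _) adj₃
      ((curriedTensor D).flip.map f)).trans (by rw [conjugateEquiv_tensorRightAdj]; rfl))
    (fun f ↦ (conjugateEquiv_whiskerLeft (tensorRightAdj _) (tensorRightAdj _) adj₃
      ((curriedTensor C).flip.map (F.map f))).trans (by rw [conjugateEquiv_tensorRightAdj]; rfl))
    ((flipFunctor D D C).mapIso (genGrothIso π adj₂ h))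
  pseudoInthom_hom _ := rfl
  urWirth := asIso (urWirthNat π adj₀ adj₂)
  urWirth_hom _ := rfl
  coWirth := conjugateIsoEquiv adj₀ ((ihom.adjunction (dualizingObj H)).comp adj₂)
    (asIso (urWirthNat π adj₀ adj₂))
  coWirth_hom := rfl
  leftProj := leftProjIso π (asIso (urWirthNat π adj₀ adj₂))
  leftProj_hom x y := by
    simp [leftProjIso, ← MonoidalCategory.whiskerLeft_comp_assoc]
  closed := conjugateNatIso
    (A := curriedTensor D ⋙ (whiskeringLeft C D D).obj L)
    (B := F ⋙ curriedTensor C ⋙ (whiskeringRight C C D).obj L) (fun x ↦ adj₀.comp (ihom.adjunction x))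
    (fun x ↦ (ihom.adjunction (F.obj x)).comp adj₀)
    (fun f ↦ conjugateEquiv_whiskerLeft (ihom.adjunction _) (ihom.adjunction _) adj₀
      ((curriedTensor D).map f))
    (fun f ↦ conjugateEquiv_whiskerRight (ihom.adjunction _) (ihom.adjunction _) adj₀
      ((curriedTensor C).map (F.map f)))
    (leftProjIso π (asIso (urWirthNat π adj₀ adj₂))).symm
  closed_hom _ := rfl
  coLeftProj := conjugateNatIso
    (A := (curriedTensor D ⋙ (whiskeringLeft C D D).obj L).flip)
    (B := (F ⋙ curriedTensor C ⋙ (whiskeringRight C C D).obj L).flip)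
    (fun x ↦ tensorRightAdj (L.obj x))
    (fun x ↦ (adj₁.comp (tensorRightAdj x)).comp adj₀)
    (fun f ↦ conjugateEquiv_tensorRightAdj (L.map f))
    (fun f ↦ (conjugateEquiv_whiskerRight (adj₁.comp (tensorRightAdj _))
      (adj₁.comp (tensorRightAdj _)) adj₀
      (whiskerLeft F ((curriedTensor C).flip.map f))).trans
        (by rw [conjugateEquiv_whiskerLeft, conjugateEquiv_tensorRightAdj]; rfl))
    ((flipFunctor D C D).mapIso (leftProjIso π (asIso (urWirthNat π adj₀ adj₂)))).symm
  coLeftProj_hom _ := rfl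
  mixed := mixedIso (asIso (grothNat π adj₂)) (asIso (urWirthNat π adj₀ adj₂))
  mixed_hom _ _ := rfl
  mixedHom := conjugateNatIso
    (A := F ⋙ curriedTensor C ⋙ (whiskeringRight C C D).obj L)
    (B := H ⋙ curriedTensor C ⋙ (whiskeringRight C C D).obj G) (fun x ↦ (ihom.adjunction (F.obj x)).comp adj₀)
    (fun x ↦ (ihom.adjunction (H.obj x)).comp adj₂)
    (fun f ↦ conjugateEquiv_whiskerRight (ihom.adjunction _) (ihom.adjunction _) adj₀
      ((curriedTensor C).map (F.map f)))
    (fun f ↦ conjugateEquiv_whiskerRight (ihom.adjunction _) (ihom.adjunction _) adj₂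
      ((curriedTensor C).map (H.map f)))
    (mixedIso (asIso (grothNat π adj₂)) (asIso (urWirthNat π adj₀ adj₂))).symm
  mixedHom_hom _ := rfl
  mixedPush := conjugateNatIso
    (A := (F ⋙ curriedTensor C ⋙ (whiskeringRight C C D).obj L).flip)
    (B := (H ⋙ curriedTensor C ⋙ (whiskeringRight C C D).obj G).flip)
    (fun x ↦ (adj₁.comp (tensorRightAdj x)).comp adj₀)
    (fun x ↦ (adj₃.comp (tensorRightAdj x)).comp adj₂)
    (fun f ↦ (conjugateEquiv_whiskerRight (adj₁.comp (tensorRightAdj _))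
      (adj₁.comp (tensorRightAdj _)) adj₀
      (whiskerLeft F ((curriedTensor C).flip.map f))).trans
        (by rw [conjugateEquiv_whiskerLeft, conjugateEquiv_tensorRightAdj]; rfl))
    (fun f ↦ (conjugateEquiv_whiskerRight (adj₃.comp (tensorRightAdj _))
      (adj₃.comp (tensorRightAdj _)) adj₂
      (whiskerLeft H ((curriedTensor C).flip.map f))).trans
        (by rw [conjugateEquiv_whiskerLeft, conjugateEquiv_tensorRightAdj]; rfl))
    ((flipFunctor D C D).mapIso
      (mixedIso (asIso (grothNat π adj₂)) (asIso (urWirthNat π adj₀ adj₂)))).symm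
  mixedPush_hom _ := rfl
  coWirthGroth := conjugateIsoEquiv adj₀ ((ihom.adjunction (dualizingObj H)).comp adj₂)
      (asIso (urWirthNat π adj₀ adj₂)) ≪≫
    isoWhiskerRight (asIso (grothNat π adj₂)).symm (ihom (dualizingObj H))
  coWirthGroth_hom _ := rfl
  unitIso := Functor.Monoidal.εIso F ≪≫
    (conjugateIsoEquiv adj₀ ((ihom.adjunction (dualizingObj H)).comp adj₂)
      (asIso (urWirthNat π adj₀ adj₂))).app (𝟙_ D)
  unitIso_hom := rfl

end Assembly

end GNDuality

end

/-! ### The duality theorem. -/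

open GNDuality in
theorem mainTheorem1
    {C : Type u₁} [Category.{v} C] [HasZeroObject C] [Preadditive C] [HasShift C ℤ]
    [∀ n : ℤ, (shiftFunctor C n).Additive] [Pretriangulated C] [IsTriangulated C]
    [MonoidalCategory C] [SymmetricCategory C] [MonoidalClosed C] [MonoidalPreadditive C]
    [(curriedTensor C).CommShift₂Int] [TensorTriangulated C]
    {D : Type u₂} [Category.{v} D] [HasZeroObject D] [Preadditive D] [HasShift D ℤ]
    [∀ n : ℤ, (shiftFunctor D n).Additive] [Pretriangulated D] [IsTriangulated D]
    [MonoidalCategory D] [SymmetricCategory D] [MonoidalClosed D] [MonoidalPreadditive D]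
    [(curriedTensor D).CommShift₂Int] [TensorTriangulated D]
    (hC : IsRigidlyCompactlyGenerated C) (hD : IsRigidlyCompactlyGenerated D)
    (F : D ⥤ C) [F.Braided] [F.CommShift ℤ] [F.IsTriangulated] (hF : PreservesCoproducts F) :
    (∃ (G : C ⥤ D) (H : D ⥤ C), Nonempty (F ⊣ G) ∧ Nonempty (G ⊣ H)) ∧
    ∀ (G : C ⥤ D) (H : D ⥤ C) (adj₁ : F ⊣ G) (adj₂ : G ⊣ H),
      List.TFAE [
        F.IsRightAdjoint,
        PreservesProducts F,
        H.IsLeftAdjoint,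
        PreservesCoproducts H,
        ∀ c : C, IsCompactObj c → IsCompactObj (G.obj c),
        Nonempty (F ⋙ tensorLeft (dualizingObj H) ≅ H)] ∧
      ∃ π : ProjIso F G,
        (∀ (x : D) (y : C), (π.hom.app x).app y = projMap adj₁ x y) ∧
        ∀ (L K : C ⥤ D) (adj₀ : L ⊣ F) (adj₃ : H ⊣ K),
          Nonempty (DualityIsos π adj₀ adj₁ adj₂ adj₃) := by
  have hex : ∃ (G : C ⥤ D) (H : D ⥤ C), Nonempty (F ⊣ G) ∧ Nonempty (G ⊣ H) := by
    have := isLeftAdjoint_of_preservesCoproducts hD.1 F hF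
    let adj₁ := Adjunction.ofIsLeftAdjoint F
    let := adj₁.rightAdjointCommShift ℤ
    have := adj₁.commShift_of_leftAdjoint ℤ
    have := adj₁.isTriangulated_rightAdjoint
    have := isLeftAdjoint_of_preservesCoproducts hC.1 F.rightAdjoint
      (preservesCoproducts_rightAdjoint hC hD adj₁)
    exact ⟨_, _, ⟨adj₁⟩, ⟨Adjunction.ofIsLeftAdjoint F.rightAdjoint⟩⟩
  refine ⟨hex, fun G H adj₁ adj₂ ↦ ?_⟩
  let π := projIso adj₁ (isIso_projMap hC hD hF adj₁)
  have hπ (x : D) (y : C) : (π.hom.app x).app y = projMap adj₁ x y := rfl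
  let := adj₁.rightAdjointCommShift ℤ
  have := adj₁.commShift_of_leftAdjoint ℤ
  have := adj₁.isTriangulated_rightAdjoint
  let := adj₂.rightAdjointCommShift ℤ
  have := adj₂.commShift_of_leftAdjoint ℤ
  have := adj₂.isTriangulated_rightAdjoint
  have := hC.1.1
  have := hD.1.1
  have hgr (hH : PreservesCoproducts H) : IsIso (grothNat π adj₂) := by
    rw [NatTrans.isIso_iff_isIso_app]
    intro y
    have := isIso_genGrothMap hC hD hF adj₁ π hπ adj₂ hH (𝟙_ D) y
    dsimp only [grothNat, grothMap]
    infer_instance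
  have tfae : List.TFAE [F.IsRightAdjoint, PreservesProducts F, H.IsLeftAdjoint,
      PreservesCoproducts H, ∀ c : C, IsCompactObj c → IsCompactObj (G.obj c),
      Nonempty (F ⋙ tensorLeft (dualizingObj H) ≅ H)] := by
    tfae_have 1 → 2 := fun h ↦ preservesProducts_of_adj (Adjunction.ofIsRightAdjoint F)
    tfae_have 2 → 5 := fun h c hc ↦
      isCompactObj_rightAdjoint_of_preservesProducts hC hD adj₁ π h hc
    tfae_have 5 → 1 := fun h ↦ by
      -- No left adjoint is assumed at this point: `f_* (ω ⊗ -)` is left adjoint to `[ω, f^{(1)}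
      -- -]`, which is isomorphic to `f^*`.
      have := isIso_coWirthNat hC hD adj₁ π hπ adj₂ h
      exact (((ihom.adjunction (dualizingObj H)).comp adj₂).ofNatIsoRight
        (asIso (coWirthNat π adj₂)).symm).isRightAdjoint
    tfae_have 5 → 4 := fun h ↦ preservesCoproducts_of_adjunction hC.1 adj₂ h
    tfae_have 4 → 5 := fun h c hc ↦ hc.of_adjunction adj₂ h
    tfae_have 4 → 3 := fun h ↦ isLeftAdjoint_of_preservesCoproducts hD.1 H h
    tfae_have 3 → 4 := fun h ↦ preservesCoproducts_of_adj (Adjunction.ofIsLeftAdjoint H)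
    tfae_have 4 → 6 := fun h ↦ by
      have := hgr h
      exact ⟨asIso (grothNat π adj₂)⟩
    -- Any natural isomorphism suffices here, since `ω ⊗ f^* -` preserves coproducts.
    tfae_have 6 → 4 := fun ⟨e⟩ ↦
      (hF.comp (preservesCoproducts_of_adj (ihom.adjunction (dualizingObj H)))).of_iso e
    tfae_finish
  refine ⟨tfae, π, hπ, fun L K adj₀ adj₃ ↦ ?_⟩
  have hH : PreservesCoproducts H := preservesCoproducts_of_adj adj₃
  have := hgr hH
  -- Conjugation reflects isomorphisms, so invertibility passes from `f^* ⟶ [ω, f^{(1)} -]` to the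
  -- ur-Wirthmüller map.
  have : IsIso (urWirthNat π adj₀ adj₂) := by
    have := isIso_coWirthNat hC hD adj₁ π hπ adj₂ ((tfae.out 3 4).1 hH)
    rw [← conjugateEquiv_urWirthNat π adj₀] at this
    exact conjugateEquiv_of_iso adj₀ ((ihom.adjunction (dualizingObj H)).comp adj₂) _
  exact ⟨dualityIsos π adj₀ adj₁ adj₂ adj₃ (isIso_genGrothMap hC hD hF adj₁ π hπ adj₂ hH)⟩
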